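/- Let $\Bbbk$ be an algebraically closed field of characteristic $0$ and $\xi\in\Bbbk$ a primitive $4$-th root of unity. Let $G=\langle x,y\mid x^4=y^2=1,\ xy=yx\rangle$ and let $H=H_{c:\sigma_0}=\Bbbk^{G}\#_{\sigma,\tau}\Bbbk\mathbb Z_2$ be Kashina's $16$-dimensional Hopf algebra, with basis $e_g\#t^s$ ($g\in G$, $s\in\{0,1\}$) and $$(e_g\#t^s)(e_h\#t^u)=\delta_{g\triangleleft t^s,h}\,\sigma(g;t^s,t^u)\,e_g\#t^{s+u},\qquad \Delta(e_g\#t^s)=\sum_{g'g''=g}\tau(g',g'';t^s)\,e_{g'}\#t^s\otimes e_{g''}\#t^s,$$ where $x\triangleleft t=xy$, $y\triangleleft t=y$, $\sigma(x^iy^j;t,t)=(-1)^{i(i-1)/2}$, $\tau(x^iy^j,x^ky^l;t)=(-1)^{jk}$, and $\sigma,\tau$ are $1$ when an argument from $\mathbb Z_2$ is trivial. Write $e_g=e_g\#1$, $t=\sum_g e_g\#t$, and let $\zeta_g,\chi_g$ be the basis of $H^*$ dual to $e_g,\ e_gt$. For $\mu\in\{x,x^3\}$ and $1\le j\le 8$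 let $Y_{\mu,j}=\Bbbk v\oplus\Bbbk w$ be the simple $\mathcal D(H)$-module on which $e_g v=\delta_{g,\mu}v$, $e_g w=\delta_{g,\mu y}w$, $\zeta_g=0$, $\chi_{x^iy^j}=\chi_x^i\chi_y^j$, $\chi_x v=w$, $\chi_x w=\beta v$, $\chi_y v=\nu v$, $\chi_y w=-\nu w$, $tv=\lambda w$, $tw=-\beta\nu\lambda v$, with $(\beta,\nu,\lambda)$ given for $j=1,\dots,8$ by * $\mu=x$: $(1,1,\xi)$, $(1,1,-\xi)$, $(-1,-1,\xi)$, $(-1,-1,-\xi)$, $(-1,1,1)$, $(-1,1,-1)$, $(1,-1,1)$, $(1,-1,-1)$; * $\mu=x^3$: $(-1,1,\xi)$, $(-1,1,-\xi)$, $(1,-1,\xi)$, $(1,-1,-\xi)$, $(1,1,1)$, $(1,1,-1)$, $(-1,-1,1)$, $(-1,-1,-1)$. Regard $Y_{\mu,j}$ as a left-left Yetter–Drinfel'd module over $H$ with coaction $u\mapsto\sum_{g}\mathcal S(e_gt)\otimes\chi_g u$ and braiding $c(u\otimes u')=u_{(-1)}\cdot u'\otimes u_{(0)}$. For a braided vector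 space $(V,c)$ let $\mathcal B(V)=\bigoplus_n V^{\otimes n}/\ker\Omega_n$ be its Nichols algebra, a quotient of $T(V)$, where $\Omega_n$ is the quantum symmetrizer: $\Omega_0=\Omega_1=\mathrm{id}$, $\Omega_n=(\Omega_{n-1}\otimes\mathrm{id})\,\Omega_{n-1,1}$, $\Omega_{n,1}=\mathrm{id}+c_n+c_nc_{n-1}+\dots+c_n\cdots c_1$, with $c_i$ being $c$ applied to the $i$-th and $(i+1)$-st factors. **Lemma.** For all $\mu\in\{x,x^3\}$ and $1\le j\le 8$ there are $r,p,m\in\Bbbk$ such that the braiding of $Y_{\mu,j}$ is $$c(v\otimes v)=r\,w\otimes w,\quad c(v\otimes w)=p\,v\otimes w,\quad c(w\otimes v)=p\,w\otimes v,\quad c(w\otimes w)=m\,v\otimes v.$$ The braided vector space $(Y_{\mu,j},c)$ is not of diagonal type, i.e. there are no basis $(x_i)$ and scalars $q_{ij}$ with $c(x_i\otimes x_j)=q_{ij}\,x_j\otimes x_i$. For these $r,p,m$ and $\mathcal B=\mathcal B(Y_{\mu,j})$: 1. If $p=-1$ and $rm=-1$, then $\mathcal B\cong T(Y_{\mu,j})/\langle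 vw,\ wv,\ v^4+w^4\rangle$ and $\dim\mathcal B=8$. 2. If $p=1$, then $\dim\mathcal B=\infty$. 3. If $rm=1$, $p=\pm\xi$ and $r=-\xi$, then $\mathcal B\cong T(Y_{\mu,j})/\langle w^2-\xi v^2,\ vwvw,\ wvwv\rangle$ and $\dim\mathcal B=16$. 4. If $rm=1$, $p=\pm\xi$ and $r=\xi$, then $\mathcal B\cong T(Y_{\mu,j})/\langle w^2+\xi v^2,\ vwvw,\ wvwv\rangle$ and $\dim\mathcal B=16$. Here each $\cong$ is an isomorphism of algebras that is the identity on the generators $v,w$. In cases 3 and 4, $\mathcal B$ is moreover isomorphic, as an abstract algebra, to the algebra presented with the opposite sign: $T(Y_{\mu,j})/\langle w^2+\xi v^2, vwvw, wvwv\rangle$ in case 3 and $T(Y_{\mu,j})/\langle w^2-\xi v^2, vwvw, wvwv\rangle$ in case 4. -/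

import Mathlib

open scoped TensorProduct

noncomputable section

namespace Kashina

/-- The group `G = ⟨x, y | x⁴ = y² = 1, xy = yx⟩`, written additively: `(i, j)` is `xⁱ yʲ`. -/
abbrev G : Type := ZMod 4 × ZMod 2

/-- The right action of `ℤ/2 = ⟨t⟩` on `G`: `x ◁ t = xy`, `y ◁ t = y`. -/
def tri (g : G) (s : ZMod 2) : G := (g.1, g.2 + (g.1.val : ZMod 2) * s)

/-- The cocycle `σ(xⁱ yʲ; t, t) = (-1)^(i(i-1)/2)`, normalised. -/
def sgm (g : G) (s u : ZMod 2) : ℤ :=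
  if s = 1 ∧ u = 1 then (-1) ^ (g.1.val * (g.1.val - 1) / 2) else 1

/-- The dual cocycle `τ(xⁱ yʲ, xᵏ yˡ; t) = (-1)^(jk)`, normalised. -/
def tau (g h : G) (s : ZMod 2) : ℤ :=
  if s = 1 then (-1) ^ (g.2.val * h.1.val) else 1

/-- The underlying space of `H`, with basis `e_g # t^s` indexed by `(g, s)`. -/
def H (k : Type*) [Field k] : Type _ := (G × ZMod 2) →₀ k

variable {k : Type*} [Field k]

instance : AddCommGroup (H k) := inferInstanceAs (AddCommGroup ((G × ZMod 2) →₀ k))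
instance : Module k (H k) := inferInstanceAs (Module k ((G × ZMod 2) →₀ k))

/-- The basis `(e_g # t^s)` of `H`. -/
def basis (k : Type*) [Field k] : Module.Basis (G × ZMod 2) k (H k) := Finsupp.basisSingleOne

/-- The element `e_g # t^s`. -/
def et (k : Type*) [Field k] (g : G) (s : ZMod 2) : H k := basis k (g, s)

lemma constr_et {M : Type*} [AddCommGroup M] [Module k M] (f : G × ZMod 2 → M) (g : G)
    (s : ZMod 2) : (basis k).constr k f (et k g s) = f (g, s) := by
  rw [et, Module.Basis.constr_basis]

lemma hom_ext {M : Type*} [AddCommGroup M] [Module k M] {f f' : H k →ₗ[k] M}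
    (h : ∀ g s, f (et k g s) = f' (et k g s)) : f = f' :=
  (basis k).ext fun ⟨g, s⟩ => h g s

/-- `(e_g # t^s)(e_h # t^u) = δ_{g ◁ t^s, h} σ(g; t^s, t^u) e_g # t^(s+u)`. -/
def mulLin (k : Type*) [Field k] : H k →ₗ[k] H k →ₗ[k] H k :=
  (basis k).constr k fun a => (basis k).constr k fun b =>
    if tri a.1 a.2 = b.1 then (sgm a.1 a.2 b.2 : k) • et k a.1 (a.2 + b.2) else 0

lemma mulLin_et (g h : G) (s u : ZMod 2) : mulLin k (et k g s) (et k h u) =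
    if tri g s = h then (sgm g s u : k) • et k g (s + u) else 0 := by
  rw [mulLin, constr_et, constr_et]

instance : Mul (H k) := ⟨fun a b => mulLin k a b⟩
instance : One (H k) := ⟨∑ g : G, et k g 0⟩

lemma mul_def (a b : H k) : a * b = mulLin k a b := rfl
lemma one_def : (1 : H k) = ∑ g : G, et k g 0 := rfl

lemma et_mul (g h : G) (s u : ZMod 2) : et k g s * et k h u =
    if tri g s = h then (sgm g s u : k) • et k g (s + u) else 0 := mulLin_et g h s u

lemma tri_tri : ∀ (g : G) (s u : ZMod 2), tri (tri g s) u = tri g (s + u) := by decide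
lemma tri_zero : ∀ (g : G), tri g 0 = g := by decide
lemma sgm_assoc : ∀ (g : G) (s u w : ZMod 2),
    sgm g s u * sgm g (s + u) w = sgm (tri g s) u w * sgm g s (u + w) := by decide

instance : Ring (H k) where
  __ := (inferInstance : AddCommGroup (H k))
  left_distrib a b c := map_add (mulLin k a) b c
  right_distrib a b c := by simp [mul_def]
  zero_mul a := by simp [mul_def]
  mul_zero a := by simp [mul_def]
  mul_assoc a b c := by
    suffices h : (mulLin k).compr₂ (mulLin k) =
        (LinearMap.lcomp k (H k →ₗ[k] H k) (mulLin k)).comp (LinearMap.llcomp k (H k) (H k) (H k) |>.comp (mulLin k)) by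
      exact congr($h a b c)
    refine hom_ext fun g s => hom_ext fun h u => hom_ext fun l w => ?_
    simp only [LinearMap.compr₂_apply, LinearMap.comp_apply, LinearMap.lcomp_apply, LinearMap.llcomp_apply, mulLin_et]
    by_cases h1 : tri g s = h
    · subst h1
      by_cases h2 : tri (tri g s) u = l
      · have h3 : tri g (s + u) = l := by rw [← tri_tri, h2]
        simp only [h2, h3, if_true, map_smul, LinearMap.smul_apply, mulLin_et, smul_smul, ← Int.cast_mul, add_assoc, sgm_assoc]
      · have h3 : ¬ tri g (s + u) = l := by rwa [← tri_tri]
        simp [h2, h3, mulLin_et]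
    · by_cases h2 : tri h u = l <;> simp [h1, h2, mulLin_et]
  one_mul a := by
    suffices h : mulLin k 1 = LinearMap.id from congr($h a)
    refine hom_ext fun g s => ?_
    simp only [one_def, map_sum, LinearMap.sum_apply, mulLin_et, tri_zero, Finset.sum_ite_eq', Finset.mem_univ, if_true, zero_add]
    simp [sgm]
  mul_one a := by
    suffices h : (mulLin k).flip 1 = LinearMap.id from congr($h a)
    refine hom_ext fun g s => ?_
    simp only [one_def, map_sum, LinearMap.sum_apply, LinearMap.flip_apply, mulLin_et, Finset.sum_ite_eq, Finset.mem_univ, if_true, add_zero]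
    simp [sgm]

instance : Algebra k (H k) := Algebra.ofModule
  (fun r a b => by simp [mul_def]) (fun r a b => by simp [mul_def])

/-- `Δ(e_g # t^s) = ∑_{g'g''=g} τ(g', g''; t^s) (e_{g'} # t^s) ⊗ (e_{g''} # t^s)`. -/
def comulLin (k : Type*) [Field k] : H k →ₗ[k] H k ⊗[k] H k :=
  (basis k).constr k fun a =>
    ∑ h : G, (tau h (a.1 - h) a.2 : k) • (et k h a.2 ⊗ₜ[k] et k (a.1 - h) a.2)

/-- `ε(e_g # t^s) = δ_{g,1}`. -/
def counitLin (k : Type*) [Field k] : H k →ₗ[k] k :=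
  (basis k).constr k fun a => if a.1 = 0 then 1 else 0

/-- `S(e_g # t^s) = σ(g⁻¹; t^s, t^(-s))⁻¹ τ(g⁻¹, g; t^s)⁻¹ e_{(g ◁ t^s)⁻¹} # t^(-s)`. -/
def antipodeLin (k : Type*) [Field k] : H k →ₗ[k] H k :=
  (basis k).constr k fun a =>
    ((sgm (-a.1) a.2 (-a.2) : k)⁻¹ * (tau (-a.1) a.1 a.2 : k)⁻¹) • et k (-(tri a.1 a.2)) (-a.2)

lemma comulLin_et (g : G) (s : ZMod 2) : comulLin k (et k g s) =
    ∑ h : G, (tau h (g - h) s : k) • (et k h s ⊗ₜ[k] et k (g - h) s) := constr_et _ _ _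
lemma counitLin_et (g : G) (s : ZMod 2) :
    counitLin k (et k g s) = if g = 0 then 1 else 0 := constr_et _ _ _
lemma antipodeLin_et (g : G) (s : ZMod 2) : antipodeLin k (et k g s) =
    ((sgm (-g) s (-s) : k)⁻¹ * (tau (-g) g s : k)⁻¹) • et k (-(tri g s)) (-s) := constr_et _ _ _

lemma tau_coassoc : ∀ (s : ZMod 2) (a b c : G),
    tau (a + b) c s * tau a b s = tau a (b + c) s * tau b c s := by decide +kernel
lemma tau_zero_left : ∀ (g : G) (s : ZMod 2), tau 0 g s = 1 := by decide
lemma tau_zero_right : ∀ (g : G) (s : ZMod 2), tau g 0 s = 1 := by decide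

instance : Coalgebra k (H k) where
  comul := comulLin k
  counit := counitLin k
  coassoc := by
    refine hom_ext fun g s => ?_
    simp only [LinearMap.comp_apply, LinearEquiv.coe_coe, comulLin_et, map_sum, map_smul,
      LinearMap.rTensor_tmul, LinearMap.lTensor_tmul, TensorProduct.sum_tmul,
      TensorProduct.tmul_sum, ← TensorProduct.smul_tmul', TensorProduct.tmul_smul,
      TensorProduct.assoc_tmul, Finset.smul_sum, smul_smul, ← Int.cast_mul]
    rw [Finset.sum_comm]
    refine Finset.sum_congr rfl fun a _ => ?_
    refine Fintype.sum_equiv (Equiv.subRight a) _ _ fun b => ?_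
    obtain ⟨c, rfl⟩ : ∃ c, b = a + c := ⟨b - a, by abel⟩
    have e1 : a + c - a = c := by abel
    have e2 : g - a - c = g - (a + c) := by abel
    have := tau_coassoc s a c (g - (a + c))
    rw [show c + (g - (a + c)) = g - a by abel] at this
    simp only [Equiv.subRight_apply, e1, e2, this]
  rTensor_counit_comp_comul := by
    refine hom_ext fun g s => ?_
    simp only [LinearMap.comp_apply, comulLin_et, map_sum, map_smul, LinearMap.rTensor_tmul, counitLin_et]
    rw [Finset.sum_eq_single 0]
    · simp [tau_zero_left]
    · intro b _ hb; simp [hb]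
    · simp
  lTensor_counit_comp_comul := by
    refine hom_ext fun g s => ?_
    simp only [LinearMap.comp_apply, comulLin_et, map_sum, map_smul, LinearMap.lTensor_tmul, counitLin_et]
    rw [Finset.sum_eq_single g]
    · simp [tau_zero_right]
    · intro b _ hb; simp [sub_eq_zero, hb.symm]
    · simp

lemma comul_et (g : G) (s : ZMod 2) : Coalgebra.comul (R := k) (et k g s) =
    ∑ h : G, (tau h (g - h) s : k) • (et k h s ⊗ₜ[k] et k (g - h) s) := constr_et _ _ _
lemma counit_et (g : G) (s : ZMod 2) :
    Coalgebra.counit (R := k) (et k g s) = if g = 0 then 1 else 0 := constr_et _ _ _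

lemma tri_add : ∀ (g h : G) (s : ZMod 2), tri (g + h) s = tri g s + tri h s := by decide
lemma tri_inj (g h : G) (s : ZMod 2) : tri g s = tri h s ↔ g = h := by
  revert g h s; decide
lemma compat_sgm_tau : ∀ (s u : ZMod 2) (g h : G),
    sgm (g + h) s u * tau g h (s + u) =
      sgm g s u * sgm h s u * (tau g h s * tau (tri g s) (tri h s) u) := by decide +kernel

instance : Bialgebra k (H k) := Bialgebra.mk' k (H k)
  (by simp [one_def, counit_et])
  (by
    intro a b
    suffices h : (LinearMap.mul k (H k)).compr₂ (Coalgebra.counit (R := k)) =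
        (LinearMap.mul k k).compl₁₂ (Coalgebra.counit (R := k)) (Coalgebra.counit (R := k)) by
      exact congr($h a b)
    refine hom_ext fun g s => hom_ext fun h u => ?_
    simp only [LinearMap.compr₂_apply, LinearMap.compl₁₂_apply, LinearMap.mul_apply', et_mul, counit_et]
    by_cases h1 : g = 0
    · subst h1
      have : tri 0 s = 0 := by revert s; decide
      have h2 : sgm 0 s u = 1 := by revert s u; decide
      by_cases h3 : h = 0 <;> simp [this, h3, h2, counit_et, eq_comm]
    · by_cases h3 : tri g s = h <;> simp [h1, h3, counit_et])
  (by
    rw [one_def, map_sum, Algebra.TensorProduct.one_def, one_def, TensorProduct.sum_tmul]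
    simp only [comul_et, TensorProduct.tmul_sum]
    rw [Finset.sum_comm]
    refine Finset.sum_congr rfl fun a _ => ?_
    refine Fintype.sum_equiv (Equiv.subRight a) _ _ fun b => ?_
    simp [tau])
  (by
    intro a b
    suffices h : (LinearMap.mul k (H k)).compr₂ (Coalgebra.comul (R := k)) =
        (LinearMap.mul k (H k ⊗[k] H k)).compl₁₂ (Coalgebra.comul (R := k)) (Coalgebra.comul (R := k)) by
      exact congr($h a b)
    refine hom_ext fun g s => hom_ext fun h u => ?_
    simp only [LinearMap.compr₂_apply, LinearMap.compl₁₂_apply, LinearMap.mul_apply', et_mul, comul_et,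
      Finset.sum_mul_sum, smul_mul_smul_comm, Algebra.TensorProduct.tmul_mul_tmul]
    have key : ∀ p q : G, ((if tri p s = q then (sgm p s u : k) • et k p (s + u) else 0) ⊗ₜ[k]
        if tri (g - p) s = h - q then (sgm (g - p) s u : k) • et k (g - p) (s + u) else 0) =
        if q = tri p s then (if tri g s = h then ((sgm p s u * sgm (g - p) s u : ℤ) : k) •
          (et k p (s + u) ⊗ₜ[k] et k (g - p) (s + u)) else 0) else 0 := by
      intro p q
      by_cases h1 : tri p s = q
      · subst h1
        have : tri (g - p) s = h - tri p s ↔ tri g s = h := by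
          rw [eq_sub_iff_add_eq, ← tri_add, sub_add_cancel]
        by_cases h2 : tri g s = h
        · simp [this, h2, TensorProduct.smul_tmul', TensorProduct.tmul_smul, smul_smul, mul_comm]
        · simp [this, h2]
      · simp [h1, Ne.symm h1]
    simp only [key, smul_ite, smul_zero, Finset.sum_ite_eq', Finset.mem_univ, if_true]
    by_cases h2 : tri g s = h
    · subst h2
      simp only [if_true, map_smul, comul_et, Finset.smul_sum, smul_smul, ← Int.cast_mul]
      refine Finset.sum_congr rfl fun p _ => ?_
      have h3 := compat_sgm_tau s u p (g - p)
      have h4 : tri g s - tri p s = tri (g - p) s := by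
        rw [sub_eq_iff_eq_add, ← tri_add, sub_add_cancel]
      rw [add_sub_cancel] at h3
      rw [h3, h4]
      congr 2
      ring
    · simp [h2])


lemma antipode_left : ∀ (s : ZMod 2) (a b : G), tri (-(tri a s)) (-s) = b ↔ b = - a := by decide +kernel
lemma antipode_right : ∀ (s : ZMod 2) (a b : G), tri a s = -(tri b s) ↔ b = - a := by decide +kernel
lemma sgm_mul_self : ∀ (g : G) (s u : ZMod 2), sgm g s u * sgm g s u = 1 := by decide
lemma tau_mul_self : ∀ (s : ZMod 2) (g h : G), tau g h s * tau g h s = 1 := by decide +kernel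
lemma sgm_inv (g : G) (s u : ZMod 2) : (sgm g s u : k)⁻¹ = sgm g s u :=
  inv_eq_of_mul_eq_one_left (by rw [← Int.cast_mul, sgm_mul_self, Int.cast_one])
lemma tau_inv (g h : G) (s : ZMod 2) : (tau g h s : k)⁻¹ = tau g h s :=
  inv_eq_of_mul_eq_one_left (by rw [← Int.cast_mul, tau_mul_self, Int.cast_one])
lemma antipode_coeff_left : ∀ (s : ZMod 2) (a : G),
    tau a (-a) s * (sgm (-a) s (-s) * tau (-a) a s * sgm (-(tri a s)) (-s) s) = 1 := by decide
lemma antipode_coeff_right : ∀ (s : ZMod 2) (a : G),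
    tau a (-a) s * (sgm a s (-s) * tau a (-a) s * sgm a s (-s)) = 1 := by decide

instance : HopfAlgebra k (H k) where
  antipode := antipodeLin k
  mul_antipode_rTensor_comul := by
    refine hom_ext fun g s => ?_
    simp only [LinearMap.comp_apply, comul_et, counit_et, map_sum, map_smul, LinearMap.rTensor_tmul,
      antipodeLin_et, LinearMap.mul'_apply, smul_mul_assoc, et_mul, antipode_left, sgm_inv, tau_inv,
      neg_add_cancel, sub_eq_neg_self]
    by_cases hg : g = 0
    · subst hg
      simp only [zero_sub, if_true, smul_smul, ← Int.cast_mul, antipode_coeff_left]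
      simp only [Int.cast_one, one_smul, Algebra.linearMap_apply, map_one, one_def]
      exact Fintype.sum_equiv ((Equiv.neg G).trans ⟨fun g => tri g s, fun g => tri g (-s),
        fun g => by beta_reduce; rw [tri_tri, add_neg_cancel, tri_zero],
        fun g => by beta_reduce; rw [tri_tri, neg_add_cancel, tri_zero]⟩) _ _
        fun a => by simp [show ∀ (s : ZMod 2) (a : G), tri (-a) s = -(tri a s) by decide]
    · simp [hg]
  mul_antipode_lTensor_comul := by
    refine hom_ext fun g s => ?_
    simp only [LinearMap.comp_apply, comul_et, counit_et, map_sum, map_smul, LinearMap.lTensor_tmul,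
      antipodeLin_et, LinearMap.mul'_apply, mul_smul_comm, et_mul, antipode_right, sgm_inv, tau_inv,
      add_neg_cancel, sub_eq_neg_self]
    by_cases hg : g = 0
    · subst hg
      simp only [zero_sub, if_true, smul_smul, ← Int.cast_mul, neg_neg, antipode_coeff_right]
      simp [one_def]
    · simp [hg]

lemma antipode_et (g : G) (s : ZMod 2) : HopfAlgebra.antipode k (et k g s) =
    ((sgm (-g) s (-s) : k)⁻¹ * (tau (-g) g s : k)⁻¹) • et k (-(tri g s)) (-s) := constr_et _ _ _


end Kashina

/-- A left-left Yetter-Drinfel'd module over a Hopf algebra `A`: a left `A`-module and a left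
`A`-comodule, `ρ(v) = v₍₋₁₎ ⊗ v₍₀₎`, with
`a₍₁₎ v₍₋₁₎ ⊗ a₍₂₎ · v₍₀₎ = (a₍₁₎ · v)₍₋₁₎ a₍₂₎ ⊗ (a₍₁₎ · v)₍₀₎`, which is the antipode-free form of
`ρ(a · v) = a₍₁₎ v₍₋₁₎ S(a₍₃₎) ⊗ a₍₂₎ · v₍₀₎`. -/
structure YetterDrinfeldModule (k A V : Type*) [Field k] [Ring A] [HopfAlgebra k A]
    [AddCommGroup V] [Module k V] where
  act : A →ₐ[k] Module.End k V
  coact : V →ₗ[k] A ⊗[k] V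
  coassoc : TensorProduct.assoc k A A V ∘ₗ (Coalgebra.comul (R := k)).rTensor V ∘ₗ coact =
    coact.lTensor A ∘ₗ coact
  counit_coact : (Coalgebra.counit (R := k)).rTensor V ∘ₗ coact = TensorProduct.mk k k V 1
  compat : ∀ (a : A) (v : V),
    TensorProduct.map (LinearMap.mul' k A) (TensorProduct.lift act.toLinearMap)
        (TensorProduct.tensorTensorTensorComm k A A A V (Coalgebra.comul (R := k) a ⊗ₜ coact v)) =
      (LinearMap.mul' k A ∘ₗ (TensorProduct.comm k A A).toLinearMap).rTensor V
        ((TensorProduct.assoc k A A V).symm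
          ((coact ∘ₗ act.toLinearMap.flip v).lTensor A
            (TensorProduct.comm k A A (Coalgebra.comul (R := k) a))))

/-- The braiding `c(v ⊗ w) = v₍₋₁₎ · w ⊗ v₍₀₎` of a Yetter-Drinfel'd module. -/
def YetterDrinfeldModule.braiding {k A V : Type*} [Field k] [Ring A] [HopfAlgebra k A]
    [AddCommGroup V] [Module k V] (M : YetterDrinfeldModule k A V) :
    V ⊗[k] V →ₗ[k] V ⊗[k] V :=
  (TensorProduct.lift M.act.toLinearMap).rTensor V ∘ₗ
    (TensorProduct.rightComm k A V V).toLinearMap ∘ₗ M.coact.rTensor V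

namespace Kashina

/-- The index `μ ∈ {x, x³}`. -/
inductive Mu
  | x
  | x3

def Mu.toG : Mu → G
  | .x => (1, 0)
  | .x3 => (3, 0)

section Matrices
variable {R : Type*} [CommRing R]

/-- The matrix of `e_g` on `Y_{μ,j}`, in the basis `(v, w)`: `v` has weight `μ`, `w` has weight
`μ y`. -/
def eMat (R : Type*) [CommRing R] (μ : Mu) (g : G) : Matrix (Fin 2) (Fin 2) R :=
  !![if g = μ.toG then 1 else 0, 0; 0, if g = μ.toG + (0, 1) then 1 else 0]

/-- The matrix of `t` on `Y_{μ,j}`; the indices `0, …, 7` of `Fin 8` stand for `j = 1, …, 8`. -/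
def tMat (ξ : R) : Mu → Fin 8 → Matrix (Fin 2) (Fin 2) R
  | .x, 0 => !![0, -ξ; ξ, 0]
  | .x, 1 => !![0, ξ; -ξ, 0]
  | .x, 2 => !![0, -ξ; ξ, 0]
  | .x, 3 => !![0, ξ; -ξ, 0]
  | .x, 4 => !![0, 1; 1, 0]
  | .x, 5 => !![0, -1; -1, 0]
  | .x, 6 => !![0, 1; 1, 0]
  | .x, 7 => !![0, -1; -1, 0]
  | .x3, 0 => !![0, ξ; ξ, 0]
  | .x3, 1 => !![0, -ξ; -ξ, 0]
  | .x3, 2 => !![0, ξ; ξ, 0]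
  | .x3, 3 => !![0, -ξ; -ξ, 0]
  | .x3, 4 => !![0, -1; 1, 0]
  | .x3, 5 => !![0, 1; -1, 0]
  | .x3, 6 => !![0, -1; 1, 0]
  | .x3, 7 => !![0, 1; -1, 0]

/-- The matrix of `χ_x` on `Y_{μ,j}`. -/
def chiX (R : Type*) [CommRing R] : Mu → Fin 8 → Matrix (Fin 2) (Fin 2) R
  | .x, 0 => !![0, 1; 1, 0]
  | .x, 1 => !![0, 1; 1, 0]
  | .x, 2 => !![0, -1; 1, 0]
  | .x, 3 => !![0, -1; 1, 0]
  | .x, 4 => !![0, -1; 1, 0]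
  | .x, 5 => !![0, -1; 1, 0]
  | .x, 6 => !![0, 1; 1, 0]
  | .x, 7 => !![0, 1; 1, 0]
  | .x3, 0 => !![0, -1; 1, 0]
  | .x3, 1 => !![0, -1; 1, 0]
  | .x3, 2 => !![0, 1; 1, 0]
  | .x3, 3 => !![0, 1; 1, 0]
  | .x3, 4 => !![0, 1; 1, 0]
  | .x3, 5 => !![0, 1; 1, 0]
  | .x3, 6 => !![0, -1; 1, 0]
  | .x3, 7 => !![0, -1; 1, 0]

/-- The matrix of `χ_y` on `Y_{μ,j}` (the same for both `μ`). -/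
def chiY (R : Type*) [CommRing R] : Fin 8 → Matrix (Fin 2) (Fin 2) R
  | 0 => !![1, 0; 0, -1]
  | 1 => !![1, 0; 0, -1]
  | 2 => !![-1, 0; 0, 1]
  | 3 => !![-1, 0; 0, 1]
  | 4 => !![1, 0; 0, -1]
  | 5 => !![1, 0; 0, -1]
  | 6 => !![-1, 0; 0, 1]
  | 7 => !![-1, 0; 0, 1]

/-- The matrix of `e_g # t^s`. -/
def actMat (ξ : R) (μ : Mu) (j : Fin 8) (g : G) (s : ZMod 2) : Matrix (Fin 2) (Fin 2) R :=
  eMat R μ g * tMat ξ μ j ^ s.val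

/-- The matrix of `χ_{xⁱ yʲ} = χ_xⁱ χ_yʲ`. -/
def chiMat (R : Type*) [CommRing R] (μ : Mu) (j : Fin 8) (g : G) : Matrix (Fin 2) (Fin 2) R :=
  chiX R μ j ^ g.1.val * chiY R j ^ g.2.val

/-- The coefficient matrix of `e_g # t` in the left coaction. -/
def coMat (R : Type*) [CommRing R] (μ : Mu) (j : Fin 8) (g : G) : Matrix (Fin 2) (Fin 2) R :=
  (sgm (tri g 1) 1 1 * tau (tri g 1) (-(tri g 1)) 1) • chiMat R μ j (-(tri g 1))

/-! Integer matrices as quadruples, on which the finitely many identities are checked. -/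

abbrev M2 : Type := (ℤ × ℤ) × (ℤ × ℤ)
def M2.mul (p q : M2) : M2 := ((p.1.1 * q.1.1 + p.1.2 * q.2.1, p.1.1 * q.1.2 + p.1.2 * q.2.2),
  (p.2.1 * q.1.1 + p.2.2 * q.2.1, p.2.1 * q.1.2 + p.2.2 * q.2.2))
def M2.smul (c : ℤ) (p : M2) : M2 := ((c * p.1.1, c * p.1.2), (c * p.2.1, c * p.2.2))
def M2.pow (p : M2) : ℕ → M2
  | 0 => ((1, 0), (0, 1))
  | n + 1 => (p.pow n).mul p
def M2.e (μ g : G) : M2 := ((if g = μ then 1 else 0, 0), (0, if g = μ + (0, 1) then 1 else 0))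
def M2.act (b n : ℤ) (μ g : G) (s : ZMod 2) : M2 :=
  (M2.e μ g).mul (M2.pow ((0, -(b * n)), (1, 0)) s.val)
def M2.chi (b n : ℤ) (g : G) : M2 :=
  (M2.pow ((0, b), (1, 0)) g.1.val).mul (M2.pow ((n, 0), (0, -n)) g.2.val)
def M2.co (b n : ℤ) (g : G) : M2 :=
  M2.smul (sgm (tri g 1) 1 1 * tau (tri g 1) (-(tri g 1)) 1) (M2.chi b n (-(tri g 1)))

def M2.toMat (p : M2) : Matrix (Fin 2) (Fin 2) R := !![(p.1.1 : R), p.1.2; p.2.1, p.2.2]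

lemma M2.toMat_mul (p q : M2) : (p.mul q).toMat (R := R) = p.toMat * q.toMat := by
  simp [M2.toMat, M2.mul]
lemma M2.toMat_smul (c : ℤ) (p : M2) : (p.smul c).toMat (R := R) = (c : R) • p.toMat := by
  simp [M2.toMat, M2.smul, Matrix.smul_of]
lemma M2.toMat_pow (p : M2) (n : ℕ) : (p.pow n).toMat (R := R) = p.toMat ^ n := by
  induction n with
  | zero => simp [M2.toMat, M2.pow, Matrix.one_fin_two]
  | succ n ih => rw [M2.pow, M2.toMat_mul, ih, pow_succ]

lemma M2.act_mul (b n : ℤ) (hb : b = 1 ∨ b = -1) (hn : n = 1 ∨ n = -1)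
    (μ : Mu) (g h : G) (s u : ZMod 2) :
    ((M2.act b n μ.toG g s).mul (M2.act b n μ.toG h u)).smul
        (if s = 1 ∧ u = 1 then -(b * n) * sgm μ.toG 1 1 else 1) =
      if tri g s = h then (M2.act b n μ.toG g (s + u)).smul (sgm g s u)
      else ((0, 0), (0, 0)) := by
  revert g h s u
  rcases hb with rfl | rfl <;> rcases hn with rfl | rfl <;> cases μ <;> decide +kernel

lemma M2.co_mul (b n : ℤ) (hb : b = 1 ∨ b = -1) (hn : n = 1 ∨ n = -1)
    (m a : G) : (M2.co b n m).mul (M2.co b n a) =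
    (M2.co b n (a + m)).smul (tau a m 1) := by
  revert m a
  rcases hb with rfl | rfl <;> rcases hn with rfl | rfl <;> decide +kernel

lemma M2.co_zero (b n : ℤ) (hb : b = 1 ∨ b = -1) (hn : n = 1 ∨ n = -1) : M2.co b n 0 = ((1, 0), (0, 1)) := by
  rcases hb with rfl | rfl <;> rcases hn with rfl | rfl <;> decide +kernel

lemma M2.compat (b n : ℤ) (hb : b = 1 ∨ b = -1) (hn : n = 1 ∨ n = -1)
    (μ : Mu) (s : ZMod 2) (a g : G) :
    ((M2.act b n μ.toG (g - a) s).mul (M2.co b n (tri a s))).smul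
        (tau a (g - a) s * sgm a s 1) =
      ((M2.co b n a).mul (M2.act b n μ.toG (g - tri a 1) s)).smul
        (tau (g - tri a 1) (tri a 1) s * sgm a 1 s) := by
  revert s a g
  rcases hb with rfl | rfl <;> rcases hn with rfl | rfl <;> cases μ <;> decide +kernel

lemma eMat_eq (μ : Mu) (g : G) : eMat R μ g = (M2.e μ.toG g).toMat := by
  simp [eMat, M2.e, M2.toMat]

set_option linter.unusedSimpArgs false in
lemma params (ξ : R) (hξ : ξ ^ 2 = -1) (μ : Mu) (j : Fin 8) : ∃ (b n : ℤ) (l : R),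
    (b = 1 ∨ b = -1) ∧ (n = 1 ∨ n = -1) ∧ chiX R μ j = M2.toMat ((0, b), (1, 0)) ∧
      chiY R j = M2.toMat ((n, 0), (0, -n)) ∧
      tMat ξ μ j = l • M2.toMat ((0, -(b * n)), (1, 0)) ∧
      l ^ 2 = ((-(b * n) * sgm μ.toG 1 1 : ℤ) : R) := by
  have h1 : sgm Mu.x.toG 1 1 = 1 := by decide
  have h3 : sgm Mu.x3.toG 1 1 = -1 := by decide
  have e : ∀ b n : ℤ, ∀ l : R, (b = 1 ∨ b = -1) → (n = 1 ∨ n = -1) →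
      chiX R μ j = !![0, (b : R); 1, 0] → chiY R j = !![(n : R), 0; 0, -n] →
      tMat ξ μ j = !![0, -(b * n * l); l, 0] → l ^ 2 = -(b * n) * (sgm μ.toG 1 1 : R) →
      ∃ (b n : ℤ) (l : R), (b = 1 ∨ b = -1) ∧ (n = 1 ∨ n = -1) ∧
        chiX R μ j = M2.toMat ((0, b), (1, 0)) ∧ chiY R j = M2.toMat ((n, 0), (0, -n)) ∧
        tMat ξ μ j = l • M2.toMat ((0, -(b * n)), (1, 0)) ∧
        l ^ 2 = ((-(b * n) * sgm μ.toG 1 1 : ℤ) : R) :=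
    fun b n l hb hn h1 h2 h3 h4 => ⟨b, n, l, hb, hn, by simpa [M2.toMat] using h1,
      by simpa [M2.toMat] using h2, by
        rw [h3]; simp [M2.toMat, Matrix.smul_of]; ring, by push_cast; exact h4⟩
  cases μ <;> fin_cases j
  · exact e 1 1 ξ (by simp) (by simp) (by simp [chiX]) (by simp [chiY]) (by simp [tMat])
      (by simp [h1, h3, hξ])
  · exact e 1 1 (-ξ) (by simp) (by simp) (by simp [chiX]) (by simp [chiY]) (by simp [tMat])
      (by simp [h1, h3, hξ])
  · exact e (-1) (-1) ξ (by simp) (by simp) (by simp [chiX]) (by simp [chiY]) (by simp [tMat])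
      (by simp [h1, h3, hξ])
  · exact e (-1) (-1) (-ξ) (by simp) (by simp) (by simp [chiX]) (by simp [chiY]) (by simp [tMat])
      (by simp [h1, h3, hξ])
  · exact e (-1) 1 1 (by simp) (by simp) (by simp [chiX]) (by simp [chiY]) (by simp [tMat])
      (by simp [h1, h3, hξ])
  · exact e (-1) 1 (-1) (by simp) (by simp) (by simp [chiX]) (by simp [chiY]) (by simp [tMat])
      (by simp [h1, h3, hξ])
  · exact e 1 (-1) 1 (by simp) (by simp) (by simp [chiX]) (by simp [chiY]) (by simp [tMat])
      (by simp [h1, h3, hξ])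
  · exact e 1 (-1) (-1) (by simp) (by simp) (by simp [chiX]) (by simp [chiY]) (by simp [tMat])
      (by simp [h1, h3, hξ])
  · exact e (-1) 1 ξ (by simp) (by simp) (by simp [chiX]) (by simp [chiY]) (by simp [tMat])
      (by simp [h1, h3, hξ])
  · exact e (-1) 1 (-ξ) (by simp) (by simp) (by simp [chiX]) (by simp [chiY]) (by simp [tMat])
      (by simp [h1, h3, hξ])
  · exact e 1 (-1) ξ (by simp) (by simp) (by simp [chiX]) (by simp [chiY]) (by simp [tMat])
      (by simp [h1, h3, hξ])
  · exact e 1 (-1) (-ξ) (by simp) (by simp) (by simp [chiX]) (by simp [chiY]) (by simp [tMat])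
      (by simp [h1, h3, hξ])
  · exact e 1 1 1 (by simp) (by simp) (by simp [chiX]) (by simp [chiY]) (by simp [tMat])
      (by simp [h1, h3, hξ])
  · exact e 1 1 (-1) (by simp) (by simp) (by simp [chiX]) (by simp [chiY]) (by simp [tMat])
      (by simp [h1, h3, hξ])
  · exact e (-1) (-1) 1 (by simp) (by simp) (by simp [chiX]) (by simp [chiY]) (by simp [tMat])
      (by simp [h1, h3, hξ])
  · exact e (-1) (-1) (-1) (by simp) (by simp) (by simp [chiX]) (by simp [chiY]) (by simp [tMat])
      (by simp [h1, h3, hξ])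

lemma actMat_mul {ξ : R} (hξ : ξ ^ 2 = -1) (μ : Mu) (j : Fin 8) (g h : G) (s u : ZMod 2) : actMat ξ μ j g s * actMat ξ μ j h u =
    if tri g s = h then (sgm g s u : R) • actMat ξ μ j g (s + u) else 0 := by
  obtain ⟨b, n, l, hb, hn, hX, hY, hT, hl⟩ := params ξ hξ μ j
  have key : ∀ g s, actMat ξ μ j g s = l ^ s.val • (M2.act b n μ.toG g s).toMat := by
    intro g s
    simp [actMat, hT, M2.act, M2.toMat_mul, M2.toMat_pow, eMat_eq, smul_pow]
  have hz : M2.toMat (R := R) ((0, 0), (0, 0)) = 0 := by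
    ext i j; fin_cases i <;> fin_cases j <;> simp [M2.toMat]
  have h2 : l ^ s.val * l ^ u.val = l ^ (s + u).val *
      ((if s = 1 ∧ u = 1 then -(b * n) * sgm μ.toG 1 1 else 1 : ℤ) : R) := by
    rcases (show ∀ s : ZMod 2, s = 0 ∨ s = 1 by decide) s with rfl | rfl <;>
    rcases (show ∀ s : ZMod 2, s = 0 ∨ s = 1 by decide) u with rfl | rfl
    · simp
    · simp
    · simp
    · simp only [← pow_add, and_self, if_true, ← hl]
      simp [show (1 + 1 : ZMod 2) = 0 by decide, ZMod.val_one]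
  have h3 := congrArg (M2.toMat (R := R)) (M2.act_mul b n hb hn μ g h s u)
  rw [M2.toMat_smul, M2.toMat_mul] at h3
  rw [key, key, smul_mul_smul_comm, h2, mul_smul, h3]
  split_ifs with h4
  · rw [M2.toMat_smul, key, smul_comm]
  · rw [hz, smul_zero]

lemma coMat_co {ξ : R} (hξ : ξ ^ 2 = -1) (μ : Mu) (j : Fin 8) : ∃ b n : ℤ, (b = 1 ∨ b = -1) ∧ (n = 1 ∨ n = -1) ∧
    (∀ g, coMat R μ j g = (M2.co b n g).toMat) ∧
    ∃ l : R, ∀ g s, actMat ξ μ j g s = l ^ s.val • (M2.act b n μ.toG g s).toMat := by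
  obtain ⟨b, n, l, hb, hn, hX, hY, hT, hl⟩ := params ξ hξ μ j
  refine ⟨b, n, hb, hn, fun g => ?_, l, fun g s => ?_⟩
  · simp [coMat, chiMat, hX, hY, M2.co, M2.chi, M2.toMat_smul, M2.toMat_mul, M2.toMat_pow,
      ← Int.cast_smul_eq_zsmul R]
  · simp [actMat, hT, M2.act, M2.toMat_mul, M2.toMat_pow, eMat_eq, smul_pow]

lemma coMat_mul {ξ : R} (hξ : ξ ^ 2 = -1) (μ : Mu) (j : Fin 8) (m a : G) :
    coMat R μ j m * coMat R μ j a = (tau a m 1 : R) • coMat R μ j (a + m) := by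
  obtain ⟨b, n, hb, hn, hC, -⟩ := coMat_co hξ μ j
  rw [hC, hC, hC, ← M2.toMat_mul, M2.co_mul b n hb hn, M2.toMat_smul]

lemma coMat_zero {ξ : R} (hξ : ξ ^ 2 = -1) (μ : Mu) (j : Fin 8) : coMat R μ j 0 = 1 := by
  obtain ⟨b, n, hb, hn, hC, -⟩ := coMat_co hξ μ j
  rw [hC, M2.co_zero b n hb hn]
  simp [M2.toMat, Matrix.one_fin_two]

lemma compatMat {ξ : R} (hξ : ξ ^ 2 = -1) (μ : Mu) (j : Fin 8) (s : ZMod 2) (a g : G) :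
    ((tau a (g - a) s * sgm a s 1 : ℤ) : R) • (actMat ξ μ j (g - a) s * coMat R μ j (tri a s)) =
      ((tau (g - tri a 1) (tri a 1) s * sgm a 1 s : ℤ) : R) •
        (coMat R μ j a * actMat ξ μ j (g - tri a 1) s) := by
  obtain ⟨b, n, hb, hn, hC, l, hA⟩ := coMat_co hξ μ j
  have := congrArg (fun p => l ^ s.val • M2.toMat (R := R) p) (M2.compat b n hb hn μ s a g)
  simp only [M2.toMat_smul, M2.toMat_mul] at this
  rw [hC, hC, hA, hA, smul_mul_assoc, mul_smul_comm, smul_comm, this, smul_comm]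

end Matrices

variable {k : Type*} [Field k]

lemma sum_eMat (μ : Mu) : ∑ g : G, eMat k μ g = 1 := by
  ext i j
  fin_cases i <;> fin_cases j <;> simp [Matrix.sum_apply, eMat]

/-- The representation of `H` on `Y_{μ,j}`. -/
def actHom {ξ : k} (hξ : ξ ^ 2 = -1) (μ : Mu) (j : Fin 8) :
    H k →ₐ[k] Module.End k (Fin 2 → k) :=
  AlgHom.ofLinearMap
    ((basis k).constr k fun a => Matrix.toLin' (actMat ξ μ j a.1 a.2))
    (by
      rw [one_def, map_sum]
      simp only [constr_et, actMat, ZMod.val_zero, pow_zero, mul_one]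
      rw [← map_sum, sum_eMat]
      exact Matrix.toLin'_one)
    (by
      intro x y
      let A : H k →ₗ[k] Module.End k (Fin 2 → k) :=
        (basis k).constr k fun a => Matrix.toLin' (actMat ξ μ j a.1 a.2)
      suffices h : (LinearMap.mul k (H k)).compr₂ A =
          (LinearMap.mul k (Module.End k (Fin 2 → k))).compl₁₂ A A from congr($h x y)
      refine hom_ext fun g s => hom_ext fun h u => ?_
      simp only [LinearMap.compr₂_apply, LinearMap.compl₁₂_apply, LinearMap.mul_apply', et_mul, A,
        constr_et]
      rw [Module.End.mul_eq_comp, ← Matrix.toLin'_mul, actMat_mul hξ]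
      split_ifs
      · rw [map_smul, constr_et, map_smul]
      · rw [map_zero, map_zero])

lemma actHom_et {ξ : k} (hξ : ξ ^ 2 = -1) (μ : Mu) (j : Fin 8) (g : G) (s : ZMod 2) :
    actHom hξ μ j (et k g s) = Matrix.toLin' (actMat ξ μ j g s) := constr_et _ _ _

/-- The left coaction `v ↦ S(v₍₁₎) ⊗ v₍₀₎` associated with the right coaction
`v ↦ v₍₀₎ ⊗ v₍₁₎ = ∑_g (ζ_g v ⊗ e_g + χ_g v ⊗ e_g t)`, where `ζ_g = 0` on `Y_{μ,j}`. -/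
def coactLin (k : Type*) [Field k] (μ : Mu) (j : Fin 8) :
    (Fin 2 → k) →ₗ[k] H k ⊗[k] (Fin 2 → k) :=
  ∑ g : G, (TensorProduct.mk k (H k) (Fin 2 → k) (HopfAlgebra.antipode k (et k g 1))) ∘ₗ
    Matrix.toLin' (chiMat k μ j g)

set_option linter.unusedSimpArgs false in
lemma coactLin_apply (μ : Mu) (j : Fin 8) (v : Fin 2 → k) : coactLin k μ j v =
    ∑ g : G, et k g 1 ⊗ₜ[k] Matrix.toLin' (coMat k μ j g) v := by
  rw [coactLin, LinearMap.sum_apply]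
  refine Fintype.sum_equiv ((Equiv.neg G).trans ⟨fun g => tri g 1, fun g => tri g 1,
    by unfold Function.LeftInverse; decide, by unfold Function.RightInverse Function.LeftInverse; decide⟩) _ _ fun a => ?_
  have h1 : tri (tri (-a) 1) 1 = - a := by revert a; decide
  have h2 : -(tri a 1) = tri (-a) 1 := by revert a; decide
  simp only [LinearMap.comp_apply, TensorProduct.mk_apply, antipode_et, sgm_inv, tau_inv,
    Equiv.trans_apply, Equiv.neg_apply, Equiv.coe_fn_mk, coMat, h1, h2, neg_neg,
    show (-1 : ZMod 2) = 1 by decide, ← Int.cast_smul_eq_zsmul k, map_smul, LinearMap.smul_apply,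
    TensorProduct.tmul_smul, ← TensorProduct.smul_tmul', Int.cast_mul]

lemma sq_of_primitive {ξ : k} (hξ : IsPrimitiveRoot ξ 4) : ξ ^ 2 = -1 := by
  have h4 : (ξ ^ 2 - 1) * (ξ ^ 2 + 1) = 0 := by linear_combination hξ.pow_eq_one
  rcases mul_eq_zero.mp h4 with h | h
  · exact absurd (sub_eq_zero.mp h) (hξ.pow_ne_one_of_pos_of_lt (by norm_num) (by norm_num))
  · exact eq_neg_of_add_eq_zero_left h

/-- The simple Yetter-Drinfel'd module `Y_{μ,j}` over `H`. -/
def Y {ξ : k} (hξ : IsPrimitiveRoot ξ 4) (μ : Mu) (j : Fin 8) :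
    YetterDrinfeldModule k (H k) (Fin 2 → k) where
  act := actHom (sq_of_primitive hξ) μ j
  coact := coactLin k μ j
  coassoc := by
    refine LinearMap.ext fun v => ?_
    simp only [LinearMap.comp_apply, coactLin_apply, map_sum, LinearMap.rTensor_tmul,
      LinearMap.lTensor_tmul, comul_et, TensorProduct.sum_tmul, TensorProduct.tmul_sum,
      LinearEquiv.coe_coe, ← TensorProduct.smul_tmul', map_smul, TensorProduct.assoc_tmul]
    rw [Finset.sum_comm]
    refine Finset.sum_congr rfl fun a _ => ?_
    refine Fintype.sum_equiv (Equiv.subRight a) _ _ fun m => ?_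
    rw [← LinearMap.comp_apply, ← Matrix.toLin'_mul, Equiv.subRight_apply, coMat_mul (sq_of_primitive hξ),
      add_sub_cancel, map_smul, LinearMap.smul_apply, TensorProduct.tmul_smul,
      TensorProduct.tmul_smul]
  counit_coact := by
    refine LinearMap.ext fun v => ?_
    simp only [LinearMap.comp_apply, coactLin_apply, map_sum, LinearMap.rTensor_tmul, counit_et]
    rw [Finset.sum_eq_single 0]
    · simp [coMat_zero (sq_of_primitive hξ)]
    · intro b _ hb; simp [hb]
    · simp
  compat := by
    intro a v
    suffices h : TensorProduct.map (LinearMap.mul' k (H k))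
          (TensorProduct.lift (actHom (sq_of_primitive hξ) μ j).toLinearMap) ∘ₗ
        (TensorProduct.tensorTensorTensorComm k (H k) (H k) (H k) (Fin 2 → k)).toLinearMap ∘ₗ
        (TensorProduct.mk k _ _).flip (coactLin k μ j v) ∘ₗ Coalgebra.comul (R := k) =
      (LinearMap.mul' k (H k) ∘ₗ (TensorProduct.comm k (H k) (H k)).toLinearMap).rTensor _ ∘ₗ
        (TensorProduct.assoc k (H k) (H k) (Fin 2 → k)).symm.toLinearMap ∘ₗ
        (coactLin k μ j ∘ₗ (actHom (sq_of_primitive hξ) μ j).toLinearMap.flip v).lTensor (H k) ∘ₗ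
        (TensorProduct.comm k (H k) (H k)).toLinearMap ∘ₗ Coalgebra.comul (R := k) from
      congr($h a)
    refine hom_ext fun g s => ?_
    simp only [LinearMap.comp_apply, comul_et, map_sum, map_smul, LinearEquiv.coe_coe,
      LinearMap.flip_apply, LinearMap.sum_apply, TensorProduct.mk_apply, coactLin_apply, TensorProduct.tmul_sum,
      TensorProduct.tensorTensorTensorComm_tmul, TensorProduct.map_tmul, LinearMap.mul'_apply,
      TensorProduct.lift.tmul, AlgHom.toLinearMap_apply, actHom_et, TensorProduct.comm_tmul,
      LinearMap.lTensor_tmul, TensorProduct.assoc_symm_tmul, LinearMap.rTensor_tmul, et_mul]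
    have hL : ∀ a n : G, (if tri a s = n then (sgm a s 1 : k) • et k a (s + 1) else 0) ⊗ₜ[k]
        Matrix.toLin' (actMat ξ μ j (g - a) s) (Matrix.toLin' (coMat k μ j n) v) =
        if tri a s = n then (sgm a s 1 : k) • (et k a (s + 1) ⊗ₜ[k]
          Matrix.toLin' (actMat ξ μ j (g - a) s * coMat k μ j n) v) else 0 := by
      intro a n
      split_ifs <;> simp [TensorProduct.smul_tmul']
    have hR : ∀ h n : G, (if tri n 1 = g - h then (sgm n 1 s : k) • et k n (1 + s) else 0) ⊗ₜ[k]
        Matrix.toLin' (coMat k μ j n) (Matrix.toLin' (actMat ξ μ j h s) v) =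
        if h = g - tri n 1 then (sgm n 1 s : k) • (et k n (1 + s) ⊗ₜ[k]
          Matrix.toLin' (coMat k μ j n * actMat ξ μ j h s) v) else 0 := by
      intro h n
      have : tri n 1 = g - h ↔ h = g - tri n 1 := by
        constructor <;> rintro h <;> rw [h] <;> abel
      simp only [this]
      split_ifs <;> simp [TensorProduct.smul_tmul']
    simp only [hL, hR, Finset.smul_sum, smul_ite, smul_zero]
    rw [Finset.sum_comm (f := fun h n => if h = g - tri n 1 then _ else _)]
    simp only [Finset.sum_ite_eq, Finset.sum_ite_eq', Finset.mem_univ, if_true]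
    refine Finset.sum_congr rfl fun a _ => ?_
    have := congr(et k a (s + 1) ⊗ₜ[k] Matrix.toLin' $(compatMat (sq_of_primitive hξ) μ j s a g) v)
    rw [map_smul, map_smul, LinearMap.smul_apply, LinearMap.smul_apply, TensorProduct.tmul_smul,
      TensorProduct.tmul_smul, Int.cast_mul, Int.cast_mul, mul_smul, mul_smul] at this
    rw [this, add_comm s 1, sub_sub_cancel]

end Kashina

/-! ### Braided vector spaces and Nichols algebras -/

/-- The quotient of the tensor algebra `T(V)` by the two-sided ideal generated by `S`. -/
abbrev TensorAlgebra.QuotBy {k V : Type*} [Field k] [AddCommGroup V] [Module k V]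
    (S : Set (TensorAlgebra k V)) : Type _ :=
  RingQuot fun a b : TensorAlgebra k V => a ∈ S ∧ b = 0

namespace BraidedSpace

variable {k V : Type*} [Field k] [AddCommGroup V] [Module k V]

/-- `(V, c)` is of diagonal type: `c(x_i ⊗ x_j) = q_ij x_j ⊗ x_i` for some finite basis `x`. -/
def IsDiagonalType (c : V ⊗[k] V →ₗ[k] V ⊗[k] V) : Prop :=
  ∃ (θ : ℕ) (x : Module.Basis (Fin θ) k V) (q : Fin θ → Fin θ → k),
    ∀ i j, c (x i ⊗ₜ x j) = q i j • (x j ⊗ₜ x i)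

/-- `V^{⊗n} ⊗ V ≃ V^{⊗(n+1)}`. -/
def snocEquiv (k V : Type*) [Field k] [AddCommGroup V] [Module k V] (n : ℕ) :
    (⨂[k]^n V) ⊗[k] V ≃ₗ[k] ⨂[k]^(n + 1) V :=
  (TensorProduct.congr (LinearEquiv.refl k _)
    (PiTensorProduct.subsingletonEquiv (R := k) (s := fun _ : Fin 1 => V) 0).symm).trans
      TensorPower.mulEquiv

/-- `f ⊗ id` on `V^{⊗(n+1)}`, for `f` on `V^{⊗n}`. -/
def tensorId {n : ℕ} (f : Module.End k (⨂[k]^n V)) : Module.End k (⨂[k]^(n + 1) V) :=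
  (snocEquiv k V n).conj (f.rTensor V)

/-- `c_{n+1} = id^{⊗n} ⊗ c` on `V^{⊗(n+2)}`, i.e. `c` on the last two tensor factors. -/
def braidLast (c : V ⊗[k] V →ₗ[k] V ⊗[k] V) (n : ℕ) : Module.End k (⨂[k]^(n + 2) V) :=
  (((TensorProduct.assoc k (⨂[k]^n V) V V).symm.trans
    ((snocEquiv k V n).rTensor V)).trans (snocEquiv k V (n + 1))).conj (c.lTensor (⨂[k]^n V))

/-- `Ω_{n,1} = id + c_n + c_n c_{n-1} + ⋯ + c_n ⋯ c_1 = id + c_n Ω_{n-1,1}` on `V^{⊗(n+1)}`. -/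
def omegaOne (c : V ⊗[k] V →ₗ[k] V ⊗[k] V) : (n : ℕ) → Module.End k (⨂[k]^(n + 1) V)
  | 0 => LinearMap.id
  | n + 1 => LinearMap.id + braidLast c n ∘ₗ tensorId (omegaOne c n)

/-- The quantum symmetrizer `Ω_n = (Ω_{n-1} ⊗ id) Ω_{n-1,1}` on `V^{⊗n}`. -/
def omega (c : V ⊗[k] V →ₗ[k] V ⊗[k] V) : (n : ℕ) → Module.End k (⨂[k]^n V)
  | 0 => LinearMap.id
  | n + 1 => tensorId (omega c n) ∘ₗ omegaOne c n

/-- The defining relations of the Nichols algebra: all elements of `ker Ω_n`, `n ≥ 0`. (For a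
braiding `c`, the sum of the `ker Ω_n` is already a two-sided ideal of `T(V)`.) -/
def nicholsRel (c : V ⊗[k] V →ₗ[k] V ⊗[k] V) : Set (TensorAlgebra k V) :=
  {a | ∃ (n : ℕ) (x : ⨂[k]^n V), omega c n x = 0 ∧ a = TensorPower.toTensorAlgebra x}

/-- The Nichols algebra `B(V, c) = T(V) / ⨁ ker Ω_n = ⨁ V^{⊗n} / ker Ω_n`. -/
abbrev NicholsAlgebra (c : V ⊗[k] V →ₗ[k] V ⊗[k] V) : Type _ :=
  TensorAlgebra.QuotBy (nicholsRel c)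

/-- `B(V, c) ≅ T(V)/⟨S⟩` as algebras, compatibly with the canonical maps from `V`. -/
def IsPresentedBy (c : V ⊗[k] V →ₗ[k] V ⊗[k] V) (S : Set (TensorAlgebra k V)) : Prop :=
  ∃ e : NicholsAlgebra c ≃ₐ[k] TensorAlgebra.QuotBy S, ∀ y : V,
    e (RingQuot.mkAlgHom k _ (TensorAlgebra.ι k y)) = RingQuot.mkAlgHom k _ (TensorAlgebra.ι k y)

/-- The braiding `c_{r,p,m}` in the standard basis `v, w` of `k²`. -/
def IsRPM {k : Type*} [Field k]
    (c : (Fin 2 → k) ⊗[k] (Fin 2 → k) →ₗ[k] (Fin 2 → k) ⊗[k] (Fin 2 → k)) (r p m : k) : Prop :=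
  let v : Fin 2 → k := Pi.single 0 1
  let w : Fin 2 → k := Pi.single 1 1
  c (v ⊗ₜ v) = r • (w ⊗ₜ w) ∧ c (v ⊗ₜ w) = p • (v ⊗ₜ w) ∧
    c (w ⊗ₜ v) = p • (w ⊗ₜ v) ∧ c (w ⊗ₜ w) = m • (v ⊗ₜ v)

end BraidedSpace

end

/-! The braided derivation `D` of T(V) satisfies D(xy) = x ⊗ y + (D(x) moved past y by c), and in
degree n + 1 this recursion on the last letter is exactly the one defining Ω_{n,1}. Since Ω_{n+1} =
(Ω_n ⊗ id) Ω_{n,1}, the kernel of Ω_{n+1} consists of the tensors whose derivatives lie in ker Ω_n ⊗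
V. Hence a cyclic right T(V)-module M to which `D` descends, with only the scalar multiples of the
cyclic vector killed by `D`, satisfies ker(T(V)_n → M) = ker Ω_n in every degree
(`omega_eq_zero_iff`).

For the finite-dimensional cases M is written down explicitly as k⁸ or k¹⁶: right multiplication by
v and w on the expected basis of words, and the two components of `D`. If the proposed relations S
act by zero on M, and the chosen words span T(V)/⟨S⟩ while mapping to the basis of M, then T(V)/⟨S⟩,
M and the Nichols algebra coincide (`DerivationModel.presents`). What remains is a finite coordinate
check (`presents_eight`, `presents_sixteen`).

For p = 1 no basis is needed. The braiding multiplies vw and wv by p and preserves the span of vv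
and ww, so Ω_n multiplies the coefficient of each alternating word by the p-factorial, here n!,
which is nonzero in characteristic 0 (`altCoeff_omega`). The representation v ↦ X E₀₁, w ↦ X E₁₀
sees only alternating words, so it descends to the Nichols algebra; there (v + w)² acts as the
transcendental X² (`not_finite_nicholsAlgebra`).

On Y_{μ,j} the braiding has m = -r and r² = p² ≠ 0 (`exists_isRPM_braiding`). Thus rm = -p² ≠ p²,
and this excludes diagonal type: any u with c(u ⊗ u) proportional to u ⊗ u would force rm = p²
(`not_isDiagonalType`). The opposite-sign presentations come from exchanging v and w. -/

noncomputable section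

namespace BraidedSpace

variable {k V : Type*} [Field k] [AddCommGroup V] [Module k V]

/-! ### Splitting off the last tensor factor -/

lemma toTensorAlgebra_snocEquiv {n : ℕ} (x : ⨂[k]^n V) (y : V) :
    TensorPower.toTensorAlgebra (snocEquiv k V n (x ⊗ₜ y)) =
      TensorPower.toTensorAlgebra x * TensorAlgebra.ι k y := by
  have h := TensorPower.toTensorAlgebra_gMul x
    ((PiTensorProduct.subsingletonEquiv (R := k) (s := fun _ : Fin 1 => V) 0).symm y)
  rw [TensorPower.gMul_eq_coe_linearMap] at h
  refine h.trans ?_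
  congr 1
  rw [PiTensorProduct.subsingletonEquiv_symm_apply', TensorPower.toTensorAlgebra_tprod,
    TensorAlgebra.tprod_apply]
  simp

lemma tensorId_snocEquiv {n : ℕ} (f : Module.End k (⨂[k]^n V)) (z : (⨂[k]^n V) ⊗[k] V) :
    tensorId f (snocEquiv k V n z) = snocEquiv k V n (f.rTensor V z) := by
  simp [tensorId, LinearEquiv.conj_apply]

lemma braidLast_snocEquiv (c : V ⊗[k] V →ₗ[k] V ⊗[k] V) (n : ℕ)
    (z : (⨂[k]^n V) ⊗[k] V) (y : V) :
    braidLast c n (snocEquiv k V (n + 1) (snocEquiv k V n z ⊗ₜ y)) =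
      snocEquiv k V (n + 1) ((snocEquiv k V n).toLinearMap.rTensor V
        ((TensorProduct.assoc k _ V V).symm
          (c.lTensor _ (TensorProduct.assoc k _ V V (z ⊗ₜ y))))) := by
  simp [braidLast, LinearEquiv.conj_apply, LinearEquiv.rTensor]
  rfl

lemma snocEquiv_surj {n : ℕ} (z : ⨂[k]^(n + 1) V) :
    ∃ t, snocEquiv k V n t = z := (snocEquiv k V n).surjective z

/-- The form in which inductions on the degree peel off the last letter. -/
lemma snocEquiv_hom_ext {n : ℕ} {W : Type*} [AddCommGroup W] [Module k W]
    {f g : (⨂[k]^(n + 1) V) →ₗ[k] W}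
    (h : ∀ x y, f (snocEquiv k V n (x ⊗ₜ y)) = g (snocEquiv k V n (x ⊗ₜ y))) : f = g := by
  have : f ∘ₗ (snocEquiv k V n).toLinearMap = g ∘ₗ (snocEquiv k V n).toLinearMap :=
    TensorProduct.ext' h
  ext1
  refine MultilinearMap.ext fun a => ?_
  obtain ⟨t, ht⟩ := snocEquiv_surj (PiTensorProduct.tprod k a)
  have := congr($this t)
  simpa [ht] using this

/-! ### Braided derivations and kernels of quantum symmetrizers -/

section Derivation

variable {M : Type*} [AddCommGroup M] [Module k M]

/-- A right `T(V)`-module `M` with an augmented cyclic vector `one` and a map `D` satisfying the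
Leibniz rule of the braided derivation `T(V) → T(V) ⊗ V`, whose kernel is spanned by `one`. -/
structure DerivationModel (c : V ⊗[k] V →ₗ[k] V ⊗[k] V) (R : V →ₗ[k] Module.End k M)
    (one : M) where
  ε : M →ₗ[k] k
  D : M →ₗ[k] M ⊗[k] V
  ε_one : ε one = 1
  ε_R : ∀ y m, ε (R y m) = 0
  D_one : D one = 0
  D_R : ∀ y m, D (R y m) = m ⊗ₜ y + (TensorProduct.lift R.flip).rTensor V
    ((TensorProduct.assoc k M V V).symm (c.lTensor M (TensorProduct.assoc k M V V (D m ⊗ₜ y))))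
  D_inj : ∀ m, D m = 0 → ∃ a : k, m = a • one

variable {c : V ⊗[k] V →ₗ[k] V ⊗[k] V} {R : V →ₗ[k] Module.End k M} {one : M}
  (𝓜 : DerivationModel c R one) {π : TensorAlgebra k V →ₗ[k] M} (hπ1 : π 1 = one)
  (hπR : ∀ x y, π (x * TensorAlgebra.ι k y) = R y (π x))

include hπ1 hπR in
-- The Leibniz rule `D_R` and the recursion Ω_{n+1,1} = id + c_{n+1}(Ω_{n,1} ⊗ id) are the same, so
-- induction on the last letter identifies them.
lemma derivation_pi (n : ℕ) (z : ⨂[k]^(n + 1) V) :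
    𝓜.D (π (TensorPower.toTensorAlgebra z)) =
      (π ∘ₗ TensorPower.toTensorAlgebra).rTensor V ((snocEquiv k V n).symm (omegaOne c n z)) := by
  induction n with
  | zero =>
    revert z
    refine fun z => congr($(snocEquiv_hom_ext (f := 𝓜.D ∘ₗ π ∘ₗ TensorPower.toTensorAlgebra)
      (g := (π ∘ₗ TensorPower.toTensorAlgebra).rTensor V ∘ₗ (snocEquiv k V 0).symm.toLinearMap)
      fun x y => ?_) z)
    -- Degree 0 consists of scalars, so only the term m ⊗ y of the Leibniz rule survives.
    have hx : 𝓜.D (π (TensorPower.toTensorAlgebra x)) = 0 := by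
      obtain ⟨a, rfl⟩ := (TensorPower.algebraMap₀ (R := k) (M := V)).surjective x
      rw [TensorPower.algebraMap₀_eq_smul_one, map_smul, TensorPower.toTensorAlgebra_gOne,
        map_smul, hπ1, map_smul, 𝓜.D_one, smul_zero]
    simp [toTensorAlgebra_snocEquiv, hπR, 𝓜.D_R, hx]
  | succ n ih =>
    refine congr($(snocEquiv_hom_ext (f := 𝓜.D ∘ₗ π ∘ₗ TensorPower.toTensorAlgebra)
      (g := (π ∘ₗ TensorPower.toTensorAlgebra).rTensor V ∘ₗ
        (snocEquiv k V (n + 1)).symm.toLinearMap ∘ₗ omegaOne c (n + 1))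
      fun x y => ?_) z)
    simp only [LinearMap.comp_apply, toTensorAlgebra_snocEquiv, hπR, 𝓜.D_R, ih, omegaOne,
      LinearMap.add_apply, LinearMap.id_apply, map_add, LinearEquiv.coe_coe,
      LinearEquiv.symm_apply_apply, LinearMap.rTensor_tmul, tensorId_snocEquiv]
    congr 1
    -- The remaining braided terms are linear in Ω_{n,1} x, so they may be compared on pure tensors,
    -- and then on pure tensors of the value of c.
    obtain ⟨t, ht⟩ := snocEquiv_surj (omegaOne c n x)
    rw [← ht, braidLast_snocEquiv, LinearEquiv.symm_apply_apply, LinearEquiv.symm_apply_apply]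
    clear ht
    induction t with
    | zero => simp
    | add a b ha hb => simp only [map_add, TensorProduct.add_tmul, ha, hb]
    | tmul a b =>
      simp only [LinearMap.rTensor_tmul, TensorProduct.assoc_tmul, LinearMap.lTensor_tmul]
      generalize c (b ⊗ₜ y) = u
      induction u with
      | zero => simp
      | add a b ha hb => simp only [map_add, TensorProduct.tmul_add, ha, hb]
      | tmul p q => simp [toTensorAlgebra_snocEquiv, hπR]

include 𝓜 hπ1 hπR in
/-- The quantum symmetrizers and `π` factor through each other. -/
lemma omega_factor (n : ℕ) :
    (∃ g : (⨂[k]^n V) →ₗ[k] M, π ∘ₗ TensorPower.toTensorAlgebra = g ∘ₗ omega c n) ∧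
    (∃ h : M →ₗ[k] (⨂[k]^n V), omega c n = h ∘ₗ π ∘ₗ TensorPower.toTensorAlgebra) := by
  induction n with
  | zero =>
    refine ⟨⟨π ∘ₗ TensorPower.toTensorAlgebra, rfl⟩,
      (LinearMap.toSpanSingleton k _ (TensorPower.algebraMap₀ (R := k) (M := V) 1)) ∘ₗ 𝓜.ε, ?_⟩
    refine LinearMap.ext fun x => ?_
    obtain ⟨a, rfl⟩ := (TensorPower.algebraMap₀ (R := k) (M := V)).surjective x
    simp only [omega, LinearMap.id_apply, LinearMap.comp_apply,
      TensorPower.algebraMap₀_eq_smul_one, map_smul, TensorPower.toTensorAlgebra_gOne, hπ1,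
      𝓜.ε_one, one_smul, LinearMap.toSpanSingleton_apply]
  | succ n ih =>
    -- Factorizations, unlike a bare equality of kernels, can be tensored with V at once; this is
    -- why the induction carries them.
    obtain ⟨⟨g, hg⟩, ⟨h, hh⟩⟩ := ih
    constructor
    · have hker : LinearMap.ker (omega c (n + 1)) ≤
          LinearMap.ker (π ∘ₗ TensorPower.toTensorAlgebra (n := n + 1)) := by
        intro z hz
        rw [LinearMap.mem_ker, omega, LinearMap.comp_apply] at hz
        rw [LinearMap.mem_ker, LinearMap.comp_apply]
        obtain ⟨t, ht⟩ := snocEquiv_surj (omegaOne c n z)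
        rw [← ht, tensorId_snocEquiv, LinearEquiv.map_eq_zero_iff] at hz
        -- Applying g ⊗ id to (Ω_n ⊗ id) Ω_{n,1} z = 0 gives the derivative of π z. So π z is a
        -- multiple of `one`, and ε, which vanishes in positive degree, shows that the multiple is
        -- zero.
        have hD : 𝓜.D (π (TensorPower.toTensorAlgebra z)) = 0 := by
          rw [derivation_pi 𝓜 hπ1 hπR, ← ht, LinearEquiv.symm_apply_apply, hg,
            LinearMap.rTensor_comp, LinearMap.comp_apply, hz, map_zero]
        obtain ⟨a, ha⟩ := 𝓜.D_inj _ hD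
        have hε : 𝓜.ε (π (TensorPower.toTensorAlgebra z)) = 0 := by
          refine congr($(snocEquiv_hom_ext (f := 𝓜.ε ∘ₗ π ∘ₗ TensorPower.toTensorAlgebra)
            (g := 0) fun x y => ?_) z)
          simp [toTensorAlgebra_snocEquiv, hπR, 𝓜.ε_R]
        rw [ha, map_smul, 𝓜.ε_one, smul_eq_mul, mul_one] at hε
        rw [ha, hε, zero_smul]
      -- The kernel inclusion defines the factor only on the range of Ω_{n+1}; over a field it
      -- extends.
      obtain ⟨g', hg'⟩ := LinearMap.exists_extend
        ((LinearMap.ker (omega c (n + 1))).liftQ _ hker ∘ₗ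
          (omega c (n + 1)).quotKerEquivRange.symm.toLinearMap)
      refine ⟨g', LinearMap.ext fun z => ?_⟩
      have := congr($hg' ⟨omega c (n + 1) z, LinearMap.mem_range_self _ z⟩)
      simp only [LinearMap.comp_apply, Submodule.subtype_apply, LinearEquiv.coe_coe] at this
      rw [LinearMap.comp_apply, LinearMap.comp_apply, this,
        LinearMap.quotKerEquivRange_symm_apply_image, Submodule.mkQ_apply, Submodule.liftQ_apply,
        LinearMap.comp_apply]
    · refine ⟨(snocEquiv k V n).toLinearMap ∘ₗ h.rTensor V ∘ₗ 𝓜.D, LinearMap.ext fun z => ?_⟩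
      obtain ⟨t, ht⟩ := snocEquiv_surj (omegaOne c n z)
      simp only [LinearMap.comp_apply, LinearEquiv.coe_coe]
      rw [derivation_pi 𝓜 hπ1 hπR, omega, LinearMap.comp_apply, ← ht, tensorId_snocEquiv, hh,
        LinearEquiv.symm_apply_apply, ← LinearMap.comp_apply, ← LinearMap.rTensor_comp]

include 𝓜 hπ1 hπR in
lemma omega_eq_zero_iff {n : ℕ} (x : ⨂[k]^n V) :
    omega c n x = 0 ↔ π (TensorPower.toTensorAlgebra x) = 0 := by
  obtain ⟨⟨g, hg⟩, ⟨h, hh⟩⟩ := omega_factor 𝓜 hπ1 hπR n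
  constructor
  · intro hx
    rw [← LinearMap.comp_apply, hg, LinearMap.comp_apply, hx, map_zero]
  · intro hx
    rw [hh, LinearMap.comp_apply, LinearMap.comp_apply, hx, map_zero]

end Derivation

/-! ### Presentations from derivation models -/

lemma quotBy_mk_eq_zero {S : Set (TensorAlgebra k V)} {s : TensorAlgebra k V} (hs : s ∈ S) :
    RingQuot.mkAlgHom k (fun a b : TensorAlgebra k V => a ∈ S ∧ b = 0) s = 0 := by
  have h := RingQuot.mkAlgHom_rel k (s := fun a b : TensorAlgebra k V => a ∈ S ∧ b = 0)
    (x := s) (y := 0) ⟨hs, rfl⟩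
  rwa [map_zero] at h

/-- The algebra map out of `T(V)/⟨S⟩` induced by a map killing `S`. -/
def quotByLift {B : Type*} [Semiring B] [Algebra k B] (S : Set (TensorAlgebra k V))
    (f : TensorAlgebra k V →ₐ[k] B) (hf : ∀ s ∈ S, f s = 0) : TensorAlgebra.QuotBy S →ₐ[k] B :=
  RingQuot.liftAlgHom k ⟨f, fun a b h => by rw [hf a h.1, h.2, map_zero]⟩

lemma quotByLift_mk {B : Type*} [Semiring B] [Algebra k B] (S : Set (TensorAlgebra k V))
    (f : TensorAlgebra k V →ₐ[k] B) (hf : ∀ s ∈ S, f s = 0) (x : TensorAlgebra k V) :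
    quotByLift S f hf (RingQuot.mkAlgHom k _ x) = f x :=
  RingQuot.liftAlgHom_mkAlgHom_apply _ _ _ _

lemma quotBy_hom_ext {B : Type*} [Semiring B] [Algebra k B] {S : Set (TensorAlgebra k V)}
    {f g : TensorAlgebra.QuotBy S →ₐ[k] B}
    (h : ∀ y, f (RingQuot.mkAlgHom k _ (TensorAlgebra.ι k y)) =
      g (RingQuot.mkAlgHom k _ (TensorAlgebra.ι k y))) : f = g :=
  RingQuot.ringQuot_ext' _ _ _ (TensorAlgebra.hom_ext (LinearMap.ext h))

/-- A derivation model on which `T(V)/⟨S⟩` acts and whose basis lifts to words spanning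
`T(V)/⟨S⟩` presents the Nichols algebra. -/
theorem DerivationModel.presents {c : V ⊗[k] V →ₗ[k] V ⊗[k] V} {ι : Type*} [Fintype ι]
    [DecidableEq ι]
    {R : V →ₗ[k] Module.End k (ι → k)} {one : ι → k} (𝓜 : DerivationModel c R one)
    (S : Set (TensorAlgebra k V))
    (hS : ∀ s ∈ S, ∃ (n : ℕ) (x : ⨂[k]^n V), s = TensorPower.toTensorAlgebra x)
    (hRS : ∀ s ∈ S, TensorAlgebra.lift k
      ((MulOpposite.opLinearEquiv k).toLinearMap ∘ₗ R) s = 0)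
    (W : ι → TensorAlgebra k V)
    (hW : ∀ i, (TensorAlgebra.lift k
      ((MulOpposite.opLinearEquiv k).toLinearMap ∘ₗ R) (W i)).unop one = Pi.single i 1)
    (ψ : (ι → k) →ₗ[k] TensorAlgebra.QuotBy S)
    (hψW : ∀ i, ψ (Pi.single i 1) = RingQuot.mkAlgHom k _ (W i))
    (hψ1 : ψ one = 1)
    (hψR : ∀ y m, ψ (R y m) = ψ m * RingQuot.mkAlgHom k _ (TensorAlgebra.ι k y)) :
    IsPresentedBy c S ∧ Module.finrank k (NicholsAlgebra c) = Fintype.card ι := by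
  -- The operators R are right multiplications, so T(V) acts through the opposite of the
  -- endomorphism algebra.
  set ρ := TensorAlgebra.lift k ((MulOpposite.opLinearEquiv k).toLinearMap ∘ₗ R) with hρ
  have hρι : ∀ y, ρ (TensorAlgebra.ι k y) = MulOpposite.op (R y) := fun y => by
    simp [hρ, TensorAlgebra.lift_ι_apply]
  let ev : (Module.End k (ι → k))ᵐᵒᵖ →ₗ[k] (ι → k) :=
    LinearMap.applyₗ one ∘ₗ (MulOpposite.opLinearEquiv k).symm.toLinearMap
  have hev : ∀ a, ev a = a.unop one := fun a => rfl
  let π : TensorAlgebra k V →ₗ[k] (ι → k) := ev ∘ₗ ρ.toLinearMap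
  have hπ : ∀ x, π x = (ρ x).unop one := fun x => rfl
  have hπ1 : π 1 = one := by simp [hπ]
  have hπR : ∀ x y, π (x * TensorAlgebra.ι k y) = R y (π x) := fun x y => by
    simp [hπ, hρι]
  -- ψ is a map of right T(V)-modules with ψ(one) = 1, so ψ ∘ π is the quotient map. Elements killed
  -- by π are therefore consequences of S.
  have hψπ : ∀ x, ψ (π x) = RingQuot.mkAlgHom k _ x := by
    have key : ∀ x u, ψ ((ρ x).unop u) = ψ u * RingQuot.mkAlgHom k _ x := by
      intro x
      induction x using TensorAlgebra.induction with
      | algebraMap a =>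
        intro u
        rw [AlgHom.commutes, AlgHom.commutes, Algebra.algebraMap_eq_smul_one,
          Algebra.algebraMap_eq_smul_one]
        simp
      | ι y => intro u; rw [hρι]; exact hψR y u
      | mul a b ha hb =>
        intro u
        rw [map_mul, MulOpposite.unop_mul, Module.End.mul_apply, hb, ha, map_mul, mul_assoc]
      | add a b ha hb =>
        intro u
        rw [map_add, MulOpposite.unop_add, LinearMap.add_apply, map_add, ha, hb, map_add, mul_add]
    intro x
    rw [hπ, key, hψ1, one_mul]
  have hfwd : ∀ a ∈ nicholsRel c,
      RingQuot.mkAlgHom k (fun a b : TensorAlgebra k V => a ∈ S ∧ b = 0) a = 0 := by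
    rintro a ⟨n, x, hx, rfl⟩
    rw [omega_eq_zero_iff 𝓜 hπ1 hπR] at hx
    rw [← hψπ, hx, map_zero]
  -- Homogeneity of the relations enters here: the kernels of the Ω_n are compared with ker π one
  -- degree at a time.
  have hbwd : ∀ s ∈ S,
      RingQuot.mkAlgHom k (fun a b : TensorAlgebra k V => a ∈ nicholsRel c ∧ b = 0) s = 0 := by
    intro s hs
    obtain ⟨n, x, rfl⟩ := hS s hs
    refine quotBy_mk_eq_zero ⟨n, x, ?_, rfl⟩
    rw [omega_eq_zero_iff 𝓜 hπ1 hπR, hπ, hRS _ hs]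
    rfl
  let e : NicholsAlgebra c ≃ₐ[k] TensorAlgebra.QuotBy S :=
    AlgEquiv.ofAlgHom (quotByLift _ _ hfwd) (quotByLift _ _ hbwd)
      (quotBy_hom_ext fun y => by simp [quotByLift_mk])
      (quotBy_hom_ext fun y => by simp [quotByLift_mk])
  refine ⟨⟨e, fun y => quotByLift_mk _ _ _ _⟩, ?_⟩
  let π' : TensorAlgebra.QuotBy S →ₗ[k] (ι → k) := ev ∘ₗ (quotByLift S ρ hRS).toLinearMap
  have hπ' : ∀ x, π' (RingQuot.mkAlgHom k _ x) = π x := fun x => by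
    simp only [π', LinearMap.comp_apply, AlgHom.toLinearMap_apply, quotByLift_mk]
    rfl
  have e2 : TensorAlgebra.QuotBy S ≃ₗ[k] (ι → k) := LinearEquiv.ofLinearMap π' ψ
    ((Pi.basisFun k ι).ext fun i => by
      simp only [Pi.basisFun_apply, LinearMap.comp_apply, hψW, hπ', LinearMap.id_apply]
      exact hW i)
    (LinearMap.ext fun a => by
      obtain ⟨x, rfl⟩ := RingQuot.mkAlgHom_surjective k _ a
      simp only [LinearMap.comp_apply, hπ', hψπ, LinearMap.id_apply])
  rw [e.toLinearEquiv.finrank_eq, e2.finrank_eq, Module.finrank_fintype_fun_eq_card]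

end BraidedSpace
end

noncomputable section

namespace BraidedSpace

variable {k : Type*} [Field k]

/-! ### Derivation models on two generators -/

section TwoGenerators

variable {M : Type*} [AddCommGroup M] [Module k M]

/-- The linear map `k² → End M` sending the standard basis to `Rv, Rw`. -/
def pairEnd (Rv Rw : Module.End k M) : (Fin 2 → k) →ₗ[k] Module.End k M :=
  (LinearMap.proj 0).smulRight Rv + (LinearMap.proj 1).smulRight Rw

lemma pairEnd_apply (Rv Rw : Module.End k M) (y : Fin 2 → k) :
    pairEnd Rv Rw y = y 0 • Rv + y 1 • Rw := rfl

/-- The map `M → M ⊗ k²` with components `Dv, Dw`. -/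
def pairTensor (Dv Dw : Module.End k M) : M →ₗ[k] M ⊗[k] (Fin 2 → k) :=
  (TensorProduct.mk k M (Fin 2 → k)).flip (Pi.single 0 1) ∘ₗ Dv +
    (TensorProduct.mk k M (Fin 2 → k)).flip (Pi.single 1 1) ∘ₗ Dw

lemma pairTensor_apply (Dv Dw : Module.End k M) (x : M) :
    pairTensor Dv Dw x = Dv x ⊗ₜ Pi.single 0 1 + Dw x ⊗ₜ Pi.single 1 1 := rfl

lemma pairTensor_eq_zero {Dv Dw : Module.End k M} {x : M} (h : pairTensor Dv Dw x = 0) :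
    Dv x = 0 ∧ Dw x = 0 := by
  rw [pairTensor_apply] at h
  constructor
  · simpa using congr(TensorProduct.rid k M ((LinearMap.proj 0 : (Fin 2 → k) →ₗ[k] k).lTensor M $h))
  · simpa using congr(TensorProduct.rid k M ((LinearMap.proj 1 : (Fin 2 → k) →ₗ[k] k).lTensor M $h))

lemma fin_two_eq (y : Fin 2 → k) : y = y 0 • Pi.single 0 1 + y 1 • Pi.single 1 1 := by
  ext i; fin_cases i <;> simp

/-- A derivation model for the braiding `c_{r,p,m}` from its four component operators. -/
def DerivationModel.ofPair {c : (Fin 2 → k) ⊗[k] (Fin 2 → k) →ₗ[k] (Fin 2 → k) ⊗[k] (Fin 2 → k)}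
    {r p m : k} (hc : IsRPM c r p m) {Rv Rw Dv Dw : Module.End k M} {one : M} (ε : M →ₗ[k] k)
    (hε : ε one = 1) (hεv : ∀ f, ε (Rv f) = 0) (hεw : ∀ f, ε (Rw f) = 0)
    (hDv1 : Dv one = 0) (hDw1 : Dw one = 0)
    (hvv : ∀ f, Dv (Rv f) = f + p • Rw (Dw f)) (hwv : ∀ f, Dw (Rv f) = r • Rw (Dv f))
    (hvw : ∀ f, Dv (Rw f) = m • Rv (Dw f)) (hww : ∀ f, Dw (Rw f) = f + p • Rv (Dv f))
    (hinj : ∀ f, Dv f = 0 → Dw f = 0 → ∃ a : k, f = a • one) :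
    DerivationModel c (pairEnd Rv Rw) one where
  ε := ε
  D := pairTensor Dv Dw
  ε_one := hε
  ε_R y f := by simp [pairEnd_apply, hεv, hεw]
  D_one := by simp [pairTensor_apply, hDv1, hDw1]
  D_R y f := by
    obtain ⟨h1, h2, h3, h4⟩ := hc
    -- The Leibniz rule is linear in y, so y = v and y = w suffice. Expanding D f into its two
    -- components exposes the four values of c.
    have key : ∀ y, pairTensor Dv Dw (pairEnd Rv Rw y f) = f ⊗ₜ y +
        (TensorProduct.lift (pairEnd Rv Rw).flip).rTensor (Fin 2 → k)
        ((TensorProduct.assoc k M _ _).symm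
          (c.lTensor M (TensorProduct.assoc k M _ _ (pairTensor Dv Dw f ⊗ₜ y)))) ↔
        pairTensor Dv Dw (pairEnd Rv Rw y f) = f ⊗ₜ y +
        (TensorProduct.lift (pairEnd Rv Rw).flip).rTensor (Fin 2 → k)
        ((TensorProduct.assoc k M _ _).symm
          (Dv f ⊗ₜ c (Pi.single 0 1 ⊗ₜ y) + Dw f ⊗ₜ c (Pi.single 1 1 ⊗ₜ y))) := by
      intro y
      rw [pairTensor_apply Dv Dw f, TensorProduct.add_tmul, map_add, map_add,
        TensorProduct.assoc_tmul, TensorProduct.assoc_tmul, LinearMap.lTensor_tmul,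
        LinearMap.lTensor_tmul]
    have hv := (key (Pi.single 0 1)).2 (by
      rw [h1, h3]
      simp [pairTensor_apply, pairEnd_apply, hvv, hwv, TensorProduct.add_tmul,
        ← TensorProduct.smul_tmul']
      abel)
    have hw := (key (Pi.single 1 1)).2 (by
      rw [h2, h4]
      simp [pairTensor_apply, pairEnd_apply, hvw, hww, TensorProduct.add_tmul,
        ← TensorProduct.smul_tmul']
      abel)
    rw [fin_two_eq y]
    simp only [map_add, map_smul, LinearMap.add_apply, LinearMap.smul_apply, hv, hw,
      TensorProduct.tmul_add, TensorProduct.tmul_smul, smul_add]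
    abel
  D_inj f hf := hinj f (pairTensor_eq_zero hf).1 (pairTensor_eq_zero hf).2

end TwoGenerators

/-- The generators `v, w` of `T(k²)`. -/
abbrev genV (k : Type*) [Field k] : TensorAlgebra k (Fin 2 → k) := TensorAlgebra.ι k (Pi.single 0 1)
abbrev genW (k : Type*) [Field k] : TensorAlgebra k (Fin 2 → k) := TensorAlgebra.ι k (Pi.single 1 1)

/-- Reduces a presentation to coordinate identities for four operators on k^N, with `Pi.single 0 1`
as cyclic vector and the zeroth coordinate as augmentation. The action ρ enters only through its
values on v and w, so the lift from T(V) never has to be unfolded. -/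
lemma presents_of_operators {N : ℕ} [NeZero N]
    {c : (Fin 2 → k) ⊗[k] (Fin 2 → k) →ₗ[k] (Fin 2 → k) ⊗[k] (Fin 2 → k)}
    {r p m : k} (hc : IsRPM c r p m) {Rv Rw Dv Dw : Module.End k (Fin N → k)}
    (hεv : ∀ f, Rv f 0 = 0) (hεw : ∀ f, Rw f 0 = 0)
    (hDv1 : Dv (Pi.single 0 1) = 0) (hDw1 : Dw (Pi.single 0 1) = 0)
    (hvv : ∀ f, Dv (Rv f) = f + p • Rw (Dw f)) (hwv : ∀ f, Dw (Rv f) = r • Rw (Dv f))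
    (hvw : ∀ f, Dv (Rw f) = m • Rv (Dw f)) (hww : ∀ f, Dw (Rw f) = f + p • Rv (Dv f))
    (hinj : ∀ f, Dv f = 0 → Dw f = 0 → ∀ i, i ≠ 0 → f i = 0)
    (S : Set (TensorAlgebra k (Fin 2 → k)))
    (hS : ∀ s ∈ S, ∃ (n : ℕ) (x : ⨂[k]^n (Fin 2 → k)), s = TensorPower.toTensorAlgebra x)
    (hRS : ∀ ρ : TensorAlgebra k (Fin 2 → k) →ₐ[k] (Module.End k (Fin N → k))ᵐᵒᵖ,
      ρ (genV k) = MulOpposite.op Rv → ρ (genW k) = MulOpposite.op Rw → ∀ s ∈ S, ρ s = 0)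
    (W : Fin N → TensorAlgebra k (Fin 2 → k)) (hW0 : W 0 = 1)
    (hW : ∀ ρ : TensorAlgebra k (Fin 2 → k) →ₐ[k] (Module.End k (Fin N → k))ᵐᵒᵖ,
      ρ (genV k) = MulOpposite.op Rv → ρ (genW k) = MulOpposite.op Rw → ∀ i,
        (ρ (W i)).unop (Pi.single 0 1) = Pi.single i 1)
    (hψv : ∀ f, ∑ i, Rv f i • RingQuot.mkAlgHom k (fun a b => a ∈ S ∧ b = 0) (W i) =
      (∑ i, f i • RingQuot.mkAlgHom k (fun a b => a ∈ S ∧ b = 0) (W i)) *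
        RingQuot.mkAlgHom k (fun a b => a ∈ S ∧ b = 0) (genV k))
    (hψw : ∀ f, ∑ i, Rw f i • RingQuot.mkAlgHom k (fun a b => a ∈ S ∧ b = 0) (W i) =
      (∑ i, f i • RingQuot.mkAlgHom k (fun a b => a ∈ S ∧ b = 0) (W i)) *
        RingQuot.mkAlgHom k (fun a b => a ∈ S ∧ b = 0) (genW k)) :
    IsPresentedBy c S ∧ Module.finrank k (NicholsAlgebra c) = N := by
  have 𝓜 : DerivationModel c (pairEnd Rv Rw) (Pi.single 0 1 : Fin N → k) :=
    .ofPair hc (LinearMap.proj 0) (by simp) hεv hεw hDv1 hDw1 hvv hwv hvw hww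
      fun f h1 h2 => ⟨f 0, by
        ext i
        by_cases hi : i = 0
        · subst hi; simp
        · simp [hinj f h1 h2 i hi, hi]⟩
  have hρv : TensorAlgebra.lift k ((MulOpposite.opLinearEquiv k).toLinearMap ∘ₗ pairEnd Rv Rw)
      (genV k) = MulOpposite.op Rv := by
    simp [genV, pairEnd_apply]
  have hρw : TensorAlgebra.lift k ((MulOpposite.opLinearEquiv k).toLinearMap ∘ₗ pairEnd Rv Rw)
      (genW k) = MulOpposite.op Rw := by
    simp [genW, pairEnd_apply]
  have hψ : ∀ f, (Pi.basisFun k (Fin N)).constr k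
      (fun i => RingQuot.mkAlgHom k (fun a b => a ∈ S ∧ b = 0) (W i)) f =
      ∑ i, f i • RingQuot.mkAlgHom k (fun a b => a ∈ S ∧ b = 0) (W i) := fun f => by
    simp [Module.Basis.constr_apply_fintype]
  have hψs : ∀ i, (Pi.basisFun k (Fin N)).constr k
      (fun i => RingQuot.mkAlgHom k (fun a b => a ∈ S ∧ b = 0) (W i)) (Pi.single i 1) =
      RingQuot.mkAlgHom k _ (W i) := fun i => by
    rw [← Pi.basisFun_apply, Module.Basis.constr_basis]
  have h := 𝓜.presents S hS (hRS _ hρv hρw) W (hW _ hρv hρw)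
    ((Pi.basisFun k (Fin N)).constr k
      fun i => RingQuot.mkAlgHom k (fun a b => a ∈ S ∧ b = 0) (W i)) hψs
    (by rw [hψs, hW0, map_one])
    (by
      intro y f
      rw [pairEnd_apply, LinearMap.add_apply, map_add, LinearMap.smul_apply, LinearMap.smul_apply,
        map_smul, map_smul, hψ, hψ, hψ, hψv, hψw, ← mul_smul_comm, ← mul_smul_comm, ← mul_add]
      congr 1
      conv_rhs => rw [fin_two_eq y]
      simp only [map_add, map_smul])
  rwa [Fintype.card_fin] at h

/-- Supplies the homogeneity of the relations. -/
lemma exists_tensorPower_of_word {n : ℕ} (a : Fin n → Fin 2 → k) :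
    ∃ x : ⨂[k]^n (Fin 2 → k),
      (List.ofFn fun i => TensorAlgebra.ι k (a i)).prod = TensorPower.toTensorAlgebra x :=
  ⟨PiTensorProduct.tprod k a, by
    rw [TensorPower.toTensorAlgebra_tprod, TensorAlgebra.tprod_apply]⟩

/-! ### The eight-dimensional case -/

section DimEight

/-- Right multiplication by `v` on `k⟨v, w⟩/(vw, wv, v⁴ + w⁴)` in the basis
`1, v, w, v², w², v³, w³, v⁴`. -/
def rv8 : Module.End k (Fin 8 → k) where
  toFun f := ![0, f 0, 0, f 1, 0, f 3, 0, f 5]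
  map_add' f g := by ext i; fin_cases i <;> simp
  map_smul' a f := by ext i; fin_cases i <;> simp

/-- Right multiplication by `w`. -/
def rw8 : Module.End k (Fin 8 → k) where
  toFun f := ![0, 0, f 0, 0, f 2, 0, f 4, -f 6]
  map_add' f g := by ext i; fin_cases i <;> simp; ring
  map_smul' a f := by ext i; fin_cases i <;> simp

/-- The braided derivation dual to `v`. -/
def dv8 (r : k) : Module.End k (Fin 8 → k) where
  toFun f := ![f 1, f 3 - r * f 4, 0, f 5, -(r * f 5), f 7, 0, 0]
  map_add' f g := by ext i; fin_cases i <;> simp <;> ring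
  map_smul' a f := by ext i; fin_cases i <;> simp <;> ring

/-- The braided derivation dual to `w`. -/
def dw8 (r : k) : Module.End k (Fin 8 → k) where
  toFun f := ![f 2, 0, r * f 3 + f 4, r * f 6, f 6, 0, -f 7, 0]
  map_add' f g := by ext i; fin_cases i <;> simp <;> ring
  map_smul' a f := by ext i; fin_cases i <;> simp <;> ring

lemma rv8_apply (f : Fin 8 → k) : rv8 f = ![0, f 0, 0, f 1, 0, f 3, 0, f 5] := rfl
lemma rw8_apply (f : Fin 8 → k) : rw8 f = ![0, 0, f 0, 0, f 2, 0, f 4, -f 6] := rfl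
lemma dv8_apply (r : k) (f : Fin 8 → k) :
    dv8 r f = ![f 1, f 3 - r * f 4, 0, f 5, -(r * f 5), f 7, 0, 0] := rfl
lemma dw8_apply (r : k) (f : Fin 8 → k) :
    dw8 r f = ![f 2, 0, r * f 3 + f 4, r * f 6, f 6, 0, -f 7, 0] := rfl

/-- Words lifting the basis on which `rv8` and `rw8` act. -/
abbrev words8 (k : Type*) [Field k] : Fin 8 → TensorAlgebra k (Fin 2 → k) :=
  ![1, genV k, genW k, genV k ^ 2, genW k ^ 2, genV k ^ 3, genW k ^ 3, genV k ^ 4]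

/-- The relations rewrite each basis word times a letter as a multiple of a basis word. This is the
multiplication table encoded in `rv8` and `rw8`, and it makes the words span the quotient. -/
lemma words8_mul {A : Type*} [Ring A] [Algebra k A] (φ : TensorAlgebra k (Fin 2 → k) →ₐ[k] A)
    (hφ : ∀ s ∈ ({genV k * genW k, genW k * genV k, genV k ^ 4 + genW k ^ 4} : Set _), φ s = 0)
    (f : Fin 8 → k) :
    ∑ i, rv8 f i • φ (words8 k i) = (∑ i, f i • φ (words8 k i)) * φ (genV k) ∧
    ∑ i, rw8 f i • φ (words8 k i) = (∑ i, f i • φ (words8 k i)) * φ (genW k) := by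
  have h1 := hφ (genV k * genW k) (by simp)
  have h2 := hφ (genW k * genV k) (by simp)
  have h3 := hφ (genV k ^ 4 + genW k ^ 4) (by simp)
  simp only [Fin.sum_univ_eight, rv8_apply, rw8_apply, words8]
  simp only [map_mul, map_add, map_pow] at h1 h2 h3
  simp
  generalize φ (genV k) = v at *
  generalize φ (genW k) = w at *
  have h4 : v ^ 4 * w = 0 := by rw [pow_succ, mul_assoc, h1, mul_zero]
  -- v⁵ = -w⁴v, which contains the factor wv.
  have h5 : v ^ 4 * v = 0 := by
    rw [eq_neg_of_add_eq_zero_left h3, pow_succ, neg_mul, mul_assoc, h2, mul_zero, neg_zero]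
  have h6 : w ^ 4 = - v ^ 4 := eq_neg_of_add_eq_zero_right h3
  have h7 : v ^ 2 * w = 0 := by rw [pow_succ, mul_assoc, h1, mul_zero]
  have h8 : v ^ 3 * w = 0 := by rw [pow_succ, mul_assoc, h1, mul_zero]
  have h9 : w ^ 2 * v = 0 := by rw [pow_succ, mul_assoc, h2, mul_zero]
  have h10 : w ^ 3 * v = 0 := by rw [pow_succ, mul_assoc, h2, mul_zero]
  simp [add_mul, h1, h2, h4, h5, h7, h8, h9, h10, ← pow_succ, ← pow_two, h6]

/-- The components `dv8` and `dw8` are forced by the Leibniz rule, starting from D(1) = 0. The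
identities still to be checked express that this recursion respects the relations, and use r² = 1.
-/
theorem presents_eight [CharZero k]
    {c : (Fin 2 → k) ⊗[k] (Fin 2 → k) →ₗ[k] (Fin 2 → k) ⊗[k] (Fin 2 → k)}
    {r : k} (hr : r ^ 2 = 1) (hc : IsRPM c r (-1) (-r)) :
    IsPresentedBy c {genV k * genW k, genW k * genV k, genV k ^ 4 + genW k ^ 4} ∧
      Module.finrank k (NicholsAlgebra c) = 8 := by
  refine presents_of_operators (Rv := rv8) (Rw := rw8) (Dv := dv8 r) (Dw := dw8 r) hc
    (fun f => rfl) (fun f => rfl) ?_ ?_ ?_ ?_ ?_ ?_ ?_ _ ?_ ?_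
    (words8 k) rfl ?_ ?_ ?_
  · ext i; fin_cases i <;> simp [dv8_apply]
  · ext i; fin_cases i <;> simp [dw8_apply]
  · intro f; ext i; fin_cases i <;> simp [dv8_apply, dw8_apply, rv8_apply, rw8_apply]
  · intro f; ext i; fin_cases i <;> simp [dv8_apply, dw8_apply, rv8_apply, rw8_apply]
    linear_combination -f 5 * hr
  · intro f; ext i; fin_cases i <;> simp [dv8_apply, dw8_apply, rv8_apply, rw8_apply]
    linear_combination -f 6 * hr
  · intro f; ext i; fin_cases i <;> simp [dv8_apply, dw8_apply, rv8_apply, rw8_apply]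
  · intro f h1 h2 i hi
    rw [dv8_apply] at h1
    rw [dw8_apply] at h2
    have e1 := congrFun h1 0
    have e2 := congrFun h1 1
    have e3 := congrFun h1 3
    have e4 := congrFun h1 5
    have e5 := congrFun h2 0
    have e6 := congrFun h2 2
    have e7 := congrFun h2 4
    simp at e1 e2 e3 e4 e5 e6 e7
    -- The coordinates of v² and w² solve a 2 × 2 linear system of determinant 1 + r² = 2.
    have e8 : f 4 = 0 := by
      have : (2 : k) * f 4 = 0 := by linear_combination e6 - r * e2 - f 4 * hr
      simpa using this
    have e9 : f 3 = 0 := by rw [e8] at e2; simpa using e2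
    fin_cases i <;> first | exact absurd rfl hi | assumption
  · rintro s (rfl | rfl | rfl)
    · obtain ⟨x, hx⟩ := exists_tensorPower_of_word (k := k) ![Pi.single 0 1, Pi.single 1 1]
      exact ⟨2, x, by rw [← hx]; simp⟩
    · obtain ⟨x, hx⟩ := exists_tensorPower_of_word (k := k) ![Pi.single 1 1, Pi.single 0 1]
      exact ⟨2, x, by rw [← hx]; simp⟩
    · obtain ⟨x, hx⟩ := exists_tensorPower_of_word (k := k) fun _ : Fin 4 => Pi.single 0 1
      obtain ⟨y, hy⟩ := exists_tensorPower_of_word (k := k) fun _ : Fin 4 => Pi.single 1 1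
      exact ⟨4, x + y, by rw [map_add, ← hx, ← hy]; simp [pow_succ, mul_assoc]⟩
  · rintro ρ hv hw s (rfl | rfl | rfl)
    all_goals
      simp only [map_mul, map_add, map_pow, hv, hw]
      apply MulOpposite.unop_injective
      refine LinearMap.ext fun f => ?_
      ext i
      fin_cases i <;> simp [pow_succ, rv8_apply, rw8_apply]
  · intro ρ hv hw i
    have e : (Pi.single 0 1 : Fin 8 → k) = ![1, 0, 0, 0, 0, 0, 0, 0] := by
      ext i; fin_cases i <;> rfl
    rw [e]
    fin_cases i <;> simp [hv, hw, pow_succ, rv8_apply, rw8_apply] <;>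
      (ext i; fin_cases i <;> rfl)
  · exact fun f => (words8_mul _ (fun _ => quotBy_mk_eq_zero) f).1
  · exact fun f => (words8_mul _ (fun _ => quotBy_mk_eq_zero) f).2

end DimEight

/-! ### The sixteen-dimensional cases -/

section DimSixteen

/-- Right multiplication by `v` on `k⟨v, w⟩/(w² - s v², vwvw, wvwv)` in the basis `1, v, w, v², vw, wv,
v³, v²w, vwv, wvw, v⁴, v³w, v²wv, v⁵, v⁴w, v⁶`. -/
def rv16 : Module.End k (Fin 16 → k) where
  toFun f := ![0, f 0, 0, f 1, 0, f 2, f 3, f 5,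
    f 4, 0, f 6, f 8, f 7, f 10, f 12, f 13]
  map_add' f g := by ext i; fin_cases i <;> simp
  map_smul' a f := by ext i; fin_cases i <;> simp

/-- Right multiplication by `w`. -/
def rw16 (s : k) : Module.End k (Fin 16 → k) where
  toFun f := ![0, 0, f 0, s * f 2, f 1, 0, s * f 4, f 3,
    0, f 5, s * f 7, f 6, s * f 9, s * f 11, f 10, s * f 14]
  map_add' f g := by ext i; fin_cases i <;> simp <;> ring
  map_smul' a f := by ext i; fin_cases i <;> simp <;> ring

/-- The braided derivation dual to `v`. -/
def dv16 (p : k) : Module.End k (Fin 16 → k) where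
  toFun f := ![f 1, f 3, (1 + p) * f 5, (1 + p) * f 6, p * f 8, f 7, (1 + p) * f 10, p * f 12,
    f 11, 0, p * f 13, 0, (1 + p) * f 14, p * f 15, 0, 0]
  map_add' f g := by ext i; fin_cases i <;> simp <;> ring
  map_smul' a f := by ext i; fin_cases i <;> simp <;> ring

/-- The braided derivation dual to `w`. -/
def dw16 (s p : k) : Module.End k (Fin 16 → k) where
  toFun f := ![f 2, (1 + p) * f 4, -s * f 3, (1 + p) * f 7, -s * f 6, p * f 9, p * f 11, -s * (1 + p) * f 10,
    0, -s * f 12, p * f 14, -s * (1 + p) * f 13, 0, 0, -s * p * f 15, 0]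
  map_add' f g := by ext i; fin_cases i <;> simp <;> ring
  map_smul' a f := by ext i; fin_cases i <;> simp <;> ring

lemma rv16_apply (f : Fin 16 → k) : rv16 f =
  ![0, f 0, 0, f 1, 0, f 2, f 3, f 5,
    f 4, 0, f 6, f 8, f 7, f 10, f 12, f 13] := rfl

lemma rw16_apply (s : k) (f : Fin 16 → k) : rw16 s f =
  ![0, 0, f 0, s * f 2, f 1, 0, s * f 4, f 3,
    0, f 5, s * f 7, f 6, s * f 9, s * f 11, f 10, s * f 14] := rfl

lemma dv16_apply (p : k) (f : Fin 16 → k) : dv16 p f =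
  ![f 1, f 3, (1 + p) * f 5, (1 + p) * f 6, p * f 8, f 7, (1 + p) * f 10, p * f 12,
    f 11, 0, p * f 13, 0, (1 + p) * f 14, p * f 15, 0, 0] := rfl

lemma dw16_apply (s p : k) (f : Fin 16 → k) : dw16 s p f =
  ![f 2, (1 + p) * f 4, -s * f 3, (1 + p) * f 7, -s * f 6, p * f 9, p * f 11, -s * (1 + p) * f 10,
    0, -s * f 12, p * f 14, -s * (1 + p) * f 13, 0, 0, -s * p * f 15, 0] := rfl

/-- Words lifting the basis on which `rv16` and `rw16` act. -/
abbrev words16 (k : Type*) [Field k] : Fin 16 → TensorAlgebra k (Fin 2 → k) :=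
  ![1, genV k, genW k, genV k ^ 2, genV k * genW k, genW k * genV k, genV k ^ 3,
    genV k ^ 2 * genW k, genV k * genW k * genV k, genW k * genV k * genW k, genV k ^ 4,
    genV k ^ 3 * genW k, genV k ^ 2 * genW k * genV k, genV k ^ 5, genV k ^ 4 * genW k, genV k ^ 6]

/-- The relations `w² - s v², vwvw, wvwv`. -/
abbrev rel16 {k : Type*} [Field k] (s : k) : Set (TensorAlgebra k (Fin 2 → k)) :=
  {genW k ^ 2 - s • genV k ^ 2, genV k * genW k * genV k * genW k,
    genW k * genV k * genW k * genV k}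

/-- Since v² = s⁻¹w² commutes with w, squares of letters can be moved to the left and written as v².
The two alternating relations then cut the words off above v⁶. -/
lemma words16_mul {A : Type*} [Ring A] [Algebra k A] {s : k} (hs : s ≠ 0)
    (φ : TensorAlgebra k (Fin 2 → k) →ₐ[k] A) (hφ : ∀ x ∈ rel16 s, φ x = 0) (f : Fin 16 → k) :
    ∑ i, rv16 f i • φ (words16 k i) = (∑ i, f i • φ (words16 k i)) * φ (genV k) ∧
    ∑ i, rw16 s f i • φ (words16 k i) = (∑ i, f i • φ (words16 k i)) * φ (genW k) := by
  have h1 := hφ (genW k ^ 2 - s • genV k ^ 2) (by simp)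
  have h2 := hφ (genV k * genW k * genV k * genW k) (by simp)
  have h3 := hφ (genW k * genV k * genW k * genV k) (by simp)
  simp only [Fin.sum_univ_succ, Fin.sum_univ_zero, rv16_apply, rw16_apply, words16]
  simp only [map_mul, map_sub, map_pow, map_smul] at h1 h2 h3
  simp
  generalize φ (genV k) = v at *
  generalize φ (genW k) = w at *
  replace h1 : w * w = s • (v * v) := by
    rw [← pow_two, ← pow_two]; exact sub_eq_zero.mp h1
  have cancel : ∀ {a : A}, s • a = 0 → a = 0 := fun h => (smul_eq_zero.mp h).resolve_left hs
  -- Both sides times s equal w³.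
  have hc : w * (v * v) = v * (v * w) := by
    have : s • (w * (v * v)) = s • (v * (v * w)) := by
      rw [← mul_smul_comm, ← h1, ← mul_assoc, h1, smul_mul_assoc, mul_assoc]
    exact sub_eq_zero.mp (cancel (by rw [smul_sub, this, sub_self]))
  have hww : ∀ a, w * (w * a) = s • (v * (v * a)) := fun a => by
    rw [← mul_assoc, h1, smul_mul_assoc, mul_assoc]
  have hwvv : ∀ a, w * (v * (v * a)) = v * (v * (w * a)) := fun a => by
    simpa only [mul_assoc] using congr($hc * a)
  simp only [mul_assoc] at h2 h3
  -- w · wvwv = s v³wv gives v³wv = 0. Multiplying by v on the right gives v⁵w = 0, and then by w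
  -- gives s v⁷ = 0.
  have z1 : v * (v * (v * (w * v))) = 0 := cancel (by rw [← hww, h3, mul_zero])
  have z4 : v * (v * (v * (v * (v * w)))) = 0 := by
    have := congr($z1 * v)
    simpa only [mul_assoc, hc, zero_mul] using this
  have z5 : v * (v * (v * (v * (v * (v * v))))) = 0 := by
    have := congr($z4 * w)
    simp only [mul_assoc, h1, mul_smul_comm, zero_mul] at this
    exact cancel this
  constructor <;>
    simp [add_mul, pow_succ, mul_assoc, h1, h2, h3, hc, hwvv, z1, z4, z5,
      smul_smul, mul_comm s] <;> abel

lemma rel16_ops {s : k} : ∀ ρ : TensorAlgebra k (Fin 2 → k) →ₐ[k] (Module.End k (Fin 16 → k))ᵐᵒᵖ,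
    ρ (genV k) = MulOpposite.op rv16 → ρ (genW k) = MulOpposite.op (rw16 s) →
    ∀ x ∈ rel16 s, ρ x = 0 := by
  rintro ρ hv hw x (rfl | rfl | rfl)
  all_goals
    simp only [map_mul, map_sub, map_pow, map_smul, hv, hw]
    apply MulOpposite.unop_injective
    refine LinearMap.ext fun f => ?_
    ext i
    fin_cases i <;> simp [pow_succ, rv16_apply, rw16_apply]

lemma words16_ops {s : k} : ∀ ρ : TensorAlgebra k (Fin 2 → k) →ₐ[k] (Module.End k (Fin 16 → k))ᵐᵒᵖ,
    ρ (genV k) = MulOpposite.op rv16 → ρ (genW k) = MulOpposite.op (rw16 s) →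
    ∀ i, (ρ (words16 k i)).unop (Pi.single 0 1) = Pi.single i 1 := by
  intro ρ hv hw i
  have e : (Pi.single 0 1 : Fin 16 → k) = ![1, 0, 0, 0, 0, 0, 0, 0, 0, 0, 0, 0, 0, 0, 0, 0] := by
    ext i; fin_cases i <;> rfl
  rw [e]
  fin_cases i <;> simp [hv, hw, pow_succ, rv16_apply, rw16_apply] <;>
    (ext i; fin_cases i <;> rfl)

/-- Since p² = -1, both p and 1 + p are invertible. Every coordinate of positive degree then occurs,
up to a unit, as a single entry of one of the two derivatives, so only constants are killed. -/
theorem presents_sixteen [CharZero k]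
    {c : (Fin 2 → k) ⊗[k] (Fin 2 → k) →ₗ[k] (Fin 2 → k) ⊗[k] (Fin 2 → k)}
    {s p : k} (hs : s ^ 2 = -1) (hp : p ^ 2 = -1) (hc : IsRPM c (-s) p s) :
    IsPresentedBy c (rel16 s) ∧ Module.finrank k (NicholsAlgebra c) = 16 := by
  have hs0 : s ≠ 0 := by rintro rfl; norm_num at hs
  have hp0 : p ≠ 0 := by rintro rfl; norm_num at hp
  -- (p - 1)(p + 1) = p² - 1 = -2.
  have hp1 : 1 + p ≠ 0 := fun h => by
    have : (2 : k) = 0 := by linear_combination hp - (p - 1) * h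
    norm_num at this
  refine presents_of_operators (Rv := rv16) (Rw := rw16 s) (Dv := dv16 p) (Dw := dw16 s p) hc
    (fun f => rfl) (fun f => rfl) ?_ ?_ ?_ ?_ ?_ ?_ ?_ _ ?_ rel16_ops (words16 k) rfl words16_ops
    (fun f => (words16_mul hs0 _ (fun _ => quotBy_mk_eq_zero) f).1)
    (fun f => (words16_mul hs0 _ (fun _ => quotBy_mk_eq_zero) f).2)
  · ext i; fin_cases i <;> simp [dv16_apply]
  · ext i; fin_cases i <;> simp [dw16_apply]
  · intro f; ext i; fin_cases i <;> simp [dv16_apply, dw16_apply, rv16_apply, rw16_apply] <;> grobner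
  · intro f; ext i; fin_cases i <;> simp [dv16_apply, dw16_apply, rv16_apply, rw16_apply] <;> grobner
  · intro f; ext i; fin_cases i <;> simp [dv16_apply, dw16_apply, rv16_apply, rw16_apply] <;> grobner
  · intro f; ext i; fin_cases i <;> simp [dv16_apply, dw16_apply, rv16_apply, rw16_apply] <;> grobner
  · intro f h1 h2 i hi
    rw [dv16_apply] at h1
    rw [dw16_apply] at h2
    have e0 := congrFun h2 0
    have e1 := congrFun h2 1
    have e5 := congrFun h2 5
    have d0 := congrFun h1 0
    have d1 := congrFun h1 1
    have d2 := congrFun h1 2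
    have d3 := congrFun h1 3
    have d4 := congrFun h1 4
    have d5 := congrFun h1 5
    have d6 := congrFun h1 6
    have d7 := congrFun h1 7
    have d8 := congrFun h1 8
    have d10 := congrFun h1 10
    have d12 := congrFun h1 12
    have d13 := congrFun h1 13
    simp [hp0, hp1] at e0 e1 e5 d0 d1 d2 d3 d4 d5 d6 d7 d8 d10 d12 d13
    fin_cases i <;> first | exact absurd rfl hi | assumption
  · rintro x (rfl | rfl | rfl)
    · obtain ⟨x, hx⟩ := exists_tensorPower_of_word (k := k) fun _ : Fin 2 => Pi.single 0 1
      obtain ⟨y, hy⟩ := exists_tensorPower_of_word (k := k) fun _ : Fin 2 => Pi.single 1 1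
      exact ⟨2, y - s • x, by rw [map_sub, map_smul, ← hx, ← hy]; simp [pow_succ]⟩
    · obtain ⟨x, hx⟩ := exists_tensorPower_of_word (k := k)
        ![Pi.single 0 1, Pi.single 1 1, Pi.single 0 1, Pi.single 1 1]
      exact ⟨4, x, by rw [← hx]; simp [mul_assoc]⟩
    · obtain ⟨x, hx⟩ := exists_tensorPower_of_word (k := k)
        ![Pi.single 1 1, Pi.single 0 1, Pi.single 1 1, Pi.single 0 1]
      exact ⟨4, x, by rw [← hx]; simp [mul_assoc]⟩

end DimSixteen

/-! ### Alternating words and infinite dimension -/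

section Alternating

/-- The coefficient, on `(k²)^{⊗n}`, of the alternating word in `v, w` whose last letter is the
`a`-th basis vector. -/
def altCoeff (k : Type*) [Field k] : (n : ℕ) → Fin 2 → (⨂[k]^n (Fin 2 → k)) →ₗ[k] k
  | 0, _ => (TensorPower.algebraMap₀ (R := k) (M := Fin 2 → k)).symm.toLinearMap
  | n + 1, a => LinearMap.mul' k k ∘ₗ
      TensorProduct.map (altCoeff k n (a + 1)) (LinearMap.proj a) ∘ₗ
        (snocEquiv k (Fin 2 → k) n).symm.toLinearMap

lemma altCoeff_snocEquiv (n : ℕ) (a : Fin 2) (t : (⨂[k]^n (Fin 2 → k)) ⊗[k] (Fin 2 → k)) :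
    altCoeff k (n + 1) a (snocEquiv k _ n t) =
      LinearMap.mul' k k (TensorProduct.map (altCoeff k n (a + 1)) (LinearMap.proj a) t) := by
  simp [altCoeff]

lemma altCoeff_tensorId {n : ℕ} {a : Fin 2} {f : Module.End k (⨂[k]^n (Fin 2 → k))} {q : k}
    (hf : ∀ x, altCoeff k n (a + 1) (f x) = q * altCoeff k n (a + 1) x)
    (z : ⨂[k]^(n + 1) (Fin 2 → k)) :
    altCoeff k (n + 1) a (tensorId f z) = q * altCoeff k (n + 1) a z := by
  refine congr($(snocEquiv_hom_ext (f := altCoeff k (n + 1) a ∘ₗ tensorId f)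
    (g := q • altCoeff k (n + 1) a) fun x y => ?_) z)
  simp [tensorId_snocEquiv, altCoeff_snocEquiv, hf, mul_assoc]

set_option maxHeartbeats 1000000 in
set_option synthInstance.maxHeartbeats 200000 in
-- Two steps back in an alternating word the letter is again a, because 1 + 1 = 0 in `Fin 2`.
lemma altCoeff_last_two (n : ℕ) (a : Fin 2) (x : ⨂[k]^n (Fin 2 → k))
    (u : (Fin 2 → k) ⊗[k] (Fin 2 → k)) :
    altCoeff k (n + 2) a (snocEquiv k _ (n + 1) ((snocEquiv k _ n).toLinearMap.rTensor _
      ((TensorProduct.assoc k _ _ _).symm (x ⊗ₜ u)))) = altCoeff k n a x *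
      LinearMap.mul' k k (TensorProduct.map (LinearMap.proj (a + 1)) (LinearMap.proj a) u) := by
  induction u with
  | zero => simp only [TensorProduct.tmul_zero, map_zero, mul_zero]
  | add u u' hu hu' => simp only [TensorProduct.tmul_add, map_add, hu, hu', mul_add]
  | tmul y y' =>
    have ha : a + 1 + 1 = a := by fin_cases a <;> rfl
    simp [altCoeff_snocEquiv, ha, mul_assoc]

set_option synthInstance.maxHeartbeats 200000 in
-- Only vw and wv contribute to alternating coefficients: c multiplies them by p, and it sends vv
-- and ww to multiples of ww and vv, which contribute nothing.
lemma altCoeff_braidLast {c : (Fin 2 → k) ⊗[k] (Fin 2 → k) →ₗ[k] (Fin 2 → k) ⊗[k] (Fin 2 → k)}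
    {r p m : k} (hc : IsRPM c r p m) {n : ℕ} {a : Fin 2} (z : ⨂[k]^(n + 2) (Fin 2 → k)) :
    altCoeff k (n + 2) a (braidLast c n z) = p * altCoeff k (n + 2) a z := by
  obtain ⟨h1, h2, h3, h4⟩ := hc
  have hκ : (LinearMap.mul' k k ∘ₗ TensorProduct.map (LinearMap.proj (a + 1)) (LinearMap.proj a)) ∘ₗ c
      = p • (LinearMap.mul' k k ∘ₗ TensorProduct.map (LinearMap.proj (a + 1) : (Fin 2 → k) →ₗ[k] k)
        (LinearMap.proj a)) := by
    refine ((Pi.basisFun k (Fin 2)).tensorProduct (Pi.basisFun k (Fin 2))).ext ?_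
    rintro ⟨i, j⟩
    fin_cases i <;> fin_cases j <;> fin_cases a <;> simp [h1, h2, h3, h4]
  have hκ' : ∀ u, LinearMap.mul' k k (TensorProduct.map (LinearMap.proj (a + 1)) (LinearMap.proj a)
      (c u)) = p * LinearMap.mul' k k (TensorProduct.map (LinearMap.proj (a + 1) : (Fin 2 → k) →ₗ[k] k)
        (LinearMap.proj a) u) := fun u => congr($hκ u)
  refine congr($(snocEquiv_hom_ext (f := altCoeff k (n + 2) a ∘ₗ braidLast c n)
    (g := p • altCoeff k (n + 2) a) fun x y => ?_) z)
  obtain ⟨t, rfl⟩ := snocEquiv_surj x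
  rw [LinearMap.comp_apply, LinearMap.smul_apply, smul_eq_mul, braidLast_snocEquiv]
  induction t with
  | zero => simp only [map_zero, TensorProduct.zero_tmul, mul_zero]
  | add t t' ht ht' =>
    simp only [map_add, TensorProduct.add_tmul, ht, ht', mul_add]
  | tmul x y' =>
    rw [TensorProduct.assoc_tmul, LinearMap.lTensor_tmul, altCoeff_last_two, hκ']
    have := altCoeff_last_two n a x (y' ⊗ₜ y)
    rw [TensorProduct.assoc_symm_tmul, LinearMap.rTensor_tmul, LinearEquiv.coe_coe] at this
    rw [this]
    ring

/-- With each braid generator acting as the scalar p, the recursion for Ω_{n,1} becomes that of the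
geometric sum. -/
lemma altCoeff_omegaOne {c : (Fin 2 → k) ⊗[k] (Fin 2 → k) →ₗ[k] (Fin 2 → k) ⊗[k] (Fin 2 → k)}
    {r p m : k} (hc : IsRPM c r p m) (n : ℕ) (a : Fin 2) (z : ⨂[k]^(n + 1) (Fin 2 → k)) :
    altCoeff k (n + 1) a (omegaOne c n z) =
      (∑ i ∈ Finset.range (n + 1), p ^ i) * altCoeff k (n + 1) a z := by
  induction n generalizing a with
  | zero => simp [omegaOne]
  | succ n ih =>
    rw [omegaOne, LinearMap.add_apply, map_add, LinearMap.comp_apply, altCoeff_braidLast hc,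
      altCoeff_tensorId (ih _), LinearMap.id_apply, geom_sum_succ (n := n + 1)]
    ring_nf

/-- The quantum symmetrizer scales the coefficient of an alternating word by a `p`-factorial. -/
lemma altCoeff_omega {c : (Fin 2 → k) ⊗[k] (Fin 2 → k) →ₗ[k] (Fin 2 → k) ⊗[k] (Fin 2 → k)}
    {r p m : k} (hc : IsRPM c r p m) (n : ℕ) (a : Fin 2) (z : ⨂[k]^n (Fin 2 → k)) :
    altCoeff k n a (omega c n z) =
      (∏ l ∈ Finset.range n, ∑ i ∈ Finset.range (l + 1), p ^ i) * altCoeff k n a z := by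
  induction n generalizing a with
  | zero => simp [omega]
  | succ n ih =>
    rw [omega, LinearMap.comp_apply, altCoeff_tensorId (ih _), altCoeff_omegaOne hc,
      Finset.prod_range_succ]
    ring

open Polynomial in
/-- The representation `v ↦ X E₀₁`, `w ↦ X E₁₀` of `T(k²)`. -/
def altRep (k : Type*) [Field k] : TensorAlgebra k (Fin 2 → k) →ₐ[k] Matrix (Fin 2) (Fin 2) k[X] :=
  TensorAlgebra.lift k ((LinearMap.proj 0).smulRight !![0, X; 0, 0] +
    (LinearMap.proj 1).smulRight !![0, 0; X, 0])

open Polynomial in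
lemma altRep_ι (y : Fin 2 → k) :
    altRep k (TensorAlgebra.ι k y) = !![0, y 0 • X; y 1 • X, 0] := by
  simp [altRep]

open Polynomial in
-- Products of E₀₁ and E₁₀ vanish unless the factors alternate. Column j receives only words whose
-- last letter has index j + 1, since v = E₀₁ ends in column 1 and w = E₁₀ in column 0; the matrix
-- power records the parity of n.
lemma altRep_toTensorAlgebra (n : ℕ) (x : ⨂[k]^n (Fin 2 → k)) (i j : Fin 2) :
    altRep k (TensorPower.toTensorAlgebra x) i j =
      altCoeff k n (j + 1) x • ((!![0, X; X, 0] : Matrix (Fin 2) (Fin 2) k[X]) ^ n) i j := by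
  induction n generalizing j with
  | zero =>
    obtain ⟨a, rfl⟩ := (TensorPower.algebraMap₀ (R := k) (M := Fin 2 → k)).surjective x
    simp only [altCoeff, LinearEquiv.coe_coe, LinearEquiv.symm_apply_apply]
    rw [TensorPower.algebraMap₀_eq_smul_one, map_smul, TensorPower.toTensorAlgebra_gOne, map_smul,
      map_one, Matrix.smul_apply, pow_zero]
  | succ n ih =>
    refine congr($(snocEquiv_hom_ext
      (f := (Matrix.entryLinearMap k k[X] i j) ∘ₗ (altRep k).toLinearMap ∘ₗ
        TensorPower.toTensorAlgebra)
      (g := (altCoeff k (n + 1) (j + 1)).smulRight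
        (((!![0, X; X, 0] : Matrix (Fin 2) (Fin 2) k[X]) ^ (n + 1)) i j)) fun x y => ?_) x)
    simp only [LinearMap.comp_apply, toTensorAlgebra_snocEquiv, AlgHom.toLinearMap_apply, map_mul,
      altRep_ι, LinearMap.smulRight_apply, altCoeff_snocEquiv, TensorProduct.map_tmul,
      LinearMap.mul'_apply, Matrix.entryLinearMap_apply, Matrix.mul_apply, Fin.sum_univ_two, ih,
      pow_succ]
    fin_cases j <;> simp [Polynomial.smul_eq_C_mul] <;> ring

theorem not_finite_nicholsAlgebra [CharZero k]
    {c : (Fin 2 → k) ⊗[k] (Fin 2 → k) →ₗ[k] (Fin 2 → k) ⊗[k] (Fin 2 → k)}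
    {r m : k} (hc : IsRPM c r 1 m) : ¬ Module.Finite k (NicholsAlgebra c) := by
  intro hfin
  have hkill : ∀ s ∈ nicholsRel c, altRep k s = 0 := by
    rintro s ⟨n, x, hx, rfl⟩
    -- At p = 1 the scalar is n!, which is nonzero in characteristic 0.
    have h0 : ∀ a, altCoeff k n a x = 0 := by
      intro a
      have h := altCoeff_omega hc n a x
      rw [hx, map_zero] at h
      refine (mul_eq_zero.mp h.symm).resolve_left (Finset.prod_ne_zero_iff.mpr fun l _ => ?_)
      simp only [one_pow, Finset.sum_const, Finset.card_range, nsmul_eq_mul, mul_one]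
      exact Nat.cast_ne_zero.mpr (Nat.succ_ne_zero l)
    ext i j : 1
    rw [altRep_toTensorAlgebra, h0, zero_smul, Matrix.zero_apply]
  -- In a finite-dimensional algebra v + w is integral over k, hence so is its image X(E₀₁ + E₁₀),
  -- whose square is the scalar matrix X².
  have hint := (IsIntegral.of_finite k (RingQuot.mkAlgHom k
    (fun a b => a ∈ nicholsRel c ∧ b = 0) (genV k + genW k))).map
      (quotByLift (nicholsRel c) (altRep k) hkill)
  rw [quotByLift_mk, map_add, altRep_ι, altRep_ι] at hint
  have h2 := hint.pow 2
  have hX : (Matrix.scalarAlgHom (Fin 2) k) ((Polynomial.X : Polynomial k) ^ 2) =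
      (!![0, (Pi.single 0 1 : Fin 2 → k) 0 • Polynomial.X;
          (Pi.single 0 1 : Fin 2 → k) 1 • Polynomial.X, 0] +
        !![0, (Pi.single 1 1 : Fin 2 → k) 0 • Polynomial.X;
          (Pi.single 1 1 : Fin 2 → k) 1 • Polynomial.X, 0]) ^ 2 := by
    ext i j : 1
    fin_cases i <;> fin_cases j <;> simp [pow_two, Matrix.mul_apply]
  rw [← hX, isIntegral_algHom_iff _ fun a b h => by simpa using congr($h 0 0)] at h2
  exact Polynomial.transcendental_X k (h2.isAlgebraic.of_pow two_pos)

end Alternating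

/-! ### Non-diagonality and uniqueness of the parameters -/

lemma not_isDiagonalType {c : (Fin 2 → k) ⊗[k] (Fin 2 → k) →ₗ[k] (Fin 2 → k) ⊗[k] (Fin 2 → k)}
    {r p m : k} (hc : IsRPM c r p m) (hr : r ≠ 0) (hm : m ≠ 0) (hrm : r * m ≠ p ^ 2) :
    ¬ IsDiagonalType c := by
  rintro ⟨θ, x, q, hx⟩
  obtain ⟨h1, h2, h3, h4⟩ := hc
  have hθ : θ = 2 := by
    have := Module.finrank_eq_card_basis x
    simpa using this.symm
  subst hθ
  -- One basis vector u with c(u ⊗ u) = q u ⊗ u already gives a contradiction.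
  have h := hx 0 0
  have hne := x.ne_zero 0
  generalize x 0 = u at h hne
  generalize q 0 0 = q at h
  have hu := fin_two_eq u
  have key : ∀ i j : Fin 2, LinearMap.mul' k k (TensorProduct.map (LinearMap.proj i)
      (LinearMap.proj j) (c (u ⊗ₜ u))) = q * (u i * u j) := fun i j => by simp [h]
  have key' : c (u ⊗ₜ u) = (u 0 * u 0 * r) • (Pi.single 1 1 ⊗ₜ Pi.single 1 1) +
      (u 0 * u 1 * p) • (Pi.single 0 1 ⊗ₜ Pi.single 1 1) +
      (u 0 * u 1 * p) • (Pi.single 1 1 ⊗ₜ Pi.single 0 1) +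
      (u 1 * u 1 * m) • (Pi.single 0 1 ⊗ₜ Pi.single 0 1) := by
    conv_lhs => rw [hu]
    simp only [TensorProduct.add_tmul, TensorProduct.tmul_add, ← TensorProduct.smul_tmul',
      TensorProduct.tmul_smul, map_add, map_smul, h1, h2, h3, h4]
    module
  rw [key'] at key
  have k00 := key 0 0
  have k01 := key 0 1
  have k11 := key 1 1
  simp at k00 k01 k11
  by_cases h0 : u 0 = 0
  · by_cases h1 : u 1 = 0
    · exact hne (by rw [hu, h0, h1]; simp)
    · rw [h0] at k00; simp [h1, hm] at k00
  · by_cases h1 : u 1 = 0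
    · rw [h1] at k11; simp [h0, hr] at k11
    · have hq : q = p := by
        have : u 0 * u 1 * (q - p) = 0 := by linear_combination -k01
        have := (mul_eq_zero.mp this).resolve_left (mul_ne_zero h0 h1)
        exact sub_eq_zero.mp this
      subst hq
      have : u 0 ^ 2 * u 1 ^ 2 * (r * m - q ^ 2) = 0 := by
        linear_combination u 1 ^ 2 * m * k11 + q * u 1 ^ 2 * k00
      have := (mul_eq_zero.mp this).resolve_left
        (mul_ne_zero (pow_ne_zero 2 h0) (pow_ne_zero 2 h1))
      exact hrm (sub_eq_zero.mp this)

lemma IsRPM.unique {c : (Fin 2 → k) ⊗[k] (Fin 2 → k) →ₗ[k] (Fin 2 → k) ⊗[k] (Fin 2 → k)}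
    {r p m r' p' m' : k} (h : IsRPM c r p m) (h' : IsRPM c r' p' m') :
    r = r' ∧ p = p' ∧ m = m' := by
  obtain ⟨h1, h2, -, h4⟩ := h
  obtain ⟨h1', h2', -, h4'⟩ := h'
  refine ⟨?_, ?_, ?_⟩
  · simpa using congr(LinearMap.mul' k k (TensorProduct.map (LinearMap.proj 1) (LinearMap.proj 1)
      $(h1.symm.trans h1')))
  · simpa using congr(LinearMap.mul' k k (TensorProduct.map (LinearMap.proj 0) (LinearMap.proj 1)
      $(h2.symm.trans h2')))
  · simpa using congr(LinearMap.mul' k k (TensorProduct.map (LinearMap.proj 0) (LinearMap.proj 0)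
      $(h4.symm.trans h4')))

/-! ### Exchanging the two generators -/

/-- Exchanging `v` and `w` changes the sign of the quadratic relation. -/
def rel16Swap {s : k} (hs : s ^ 2 = -1) :
    TensorAlgebra.QuotBy (rel16 s) →ₐ[k] TensorAlgebra.QuotBy (rel16 (-s)) :=
  quotByLift _ (TensorAlgebra.lift k ((RingQuot.mkAlgHom k _).toLinearMap ∘ₗ TensorAlgebra.ι k ∘ₗ
    LinearMap.funLeft k k (Equiv.swap (0 : Fin 2) 1))) (by
  set φ := RingQuot.mkAlgHom k (fun a b => a ∈ rel16 (-s) ∧ b = 0)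
  have hv : LinearMap.funLeft k k (Equiv.swap (0 : Fin 2) 1) (Pi.single 0 1) = Pi.single 1 1 := by
    ext i; fin_cases i <;> simp [LinearMap.funLeft_apply]
  have hw : LinearMap.funLeft k k (Equiv.swap (0 : Fin 2) 1) (Pi.single 1 1) = Pi.single 0 1 := by
    ext i; fin_cases i <;> simp [LinearMap.funLeft_apply]
  have h1 : φ (genW k ^ 2 - (-s) • genV k ^ 2) = 0 := quotBy_mk_eq_zero (by simp)
  have h2 : φ (genV k * genW k * genV k * genW k) = 0 := quotBy_mk_eq_zero (by simp)
  have h3 : φ (genW k * genV k * genW k * genV k) = 0 := quotBy_mk_eq_zero (by simp)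
  simp only [map_mul, map_sub, map_pow, map_smul] at h1 h2 h3
  rintro x (rfl | rfl | rfl)
  · simp only [map_sub, map_pow, map_smul, TensorAlgebra.lift_ι_apply, LinearMap.comp_apply, hv, hw,
      AlgHom.toLinearMap_apply]
    -- In the target w² = -s v², so v² - s w² = (1 + s²) v² = 0.
    rw [sub_eq_zero.mp h1, smul_smul, mul_neg, ← pow_two, hs, neg_neg, one_smul, sub_self]
  · simpa only [map_mul, TensorAlgebra.lift_ι_apply, LinearMap.comp_apply, hv, hw,
      AlgHom.toLinearMap_apply] using h3
  · simpa only [map_mul, TensorAlgebra.lift_ι_apply, LinearMap.comp_apply, hv, hw,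
      AlgHom.toLinearMap_apply] using h2)

lemma rel16Swap_ι {s : k} (hs : s ^ 2 = -1) (y : Fin 2 → k) :
    rel16Swap hs (RingQuot.mkAlgHom k _ (TensorAlgebra.ι k y)) =
      RingQuot.mkAlgHom k _ (TensorAlgebra.ι k (y ∘ Equiv.swap (0 : Fin 2) 1)) := by
  rw [rel16Swap, quotByLift_mk, TensorAlgebra.lift_ι_apply]
  rfl

lemma nonempty_rel16_equiv_neg {s : k} (hs : s ^ 2 = -1) :
    Nonempty (TensorAlgebra.QuotBy (rel16 s) ≃ₐ[k] TensorAlgebra.QuotBy (rel16 (-s))) := by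
  have hs' : (-s) ^ 2 = -1 := by rw [neg_sq, hs]
  obtain ⟨g, hg⟩ : ∃ g : TensorAlgebra.QuotBy (rel16 (-s)) →ₐ[k] TensorAlgebra.QuotBy (rel16 s),
      ∀ y, g (RingQuot.mkAlgHom k _ (TensorAlgebra.ι k y)) =
        RingQuot.mkAlgHom k _ (TensorAlgebra.ι k (y ∘ Equiv.swap (0 : Fin 2) 1)) := by
    -- The swap for -s lands in the quotient for -(-s), whose type is not definitionally that for s;
    -- a free parameter t absorbs the transport.
    have aux : ∀ t, t = - -s → ∃ g : TensorAlgebra.QuotBy (rel16 (-s)) →ₐ[k]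
        TensorAlgebra.QuotBy (rel16 t), ∀ y, g (RingQuot.mkAlgHom k _ (TensorAlgebra.ι k y)) =
          RingQuot.mkAlgHom k _ (TensorAlgebra.ι k (y ∘ Equiv.swap (0 : Fin 2) 1)) := by
      rintro t rfl
      exact ⟨rel16Swap hs', rel16Swap_ι hs'⟩
    exact aux s (neg_neg s).symm
  have hinv : ∀ y : Fin 2 → k, (y ∘ Equiv.swap (0 : Fin 2) 1) ∘ Equiv.swap (0 : Fin 2) 1 = y := by
    intro y; ext i; simp
  exact ⟨AlgEquiv.ofAlgHom (rel16Swap hs) g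
    (quotBy_hom_ext fun y => by simp [hg, rel16Swap_ι, hinv])
    (quotBy_hom_ext fun y => by simp [hg, rel16Swap_ι, hinv])⟩

end BraidedSpace

namespace Kashina

open BraidedSpace

variable {k : Type*} [Field k]

/-! ### The braiding of Y_{μ,j} -/

lemma braiding_tmul {ξ : k} (hξ : IsPrimitiveRoot ξ 4) (μ : Mu) (j : Fin 8) (u u' : Fin 2 → k) :
    (Y hξ μ j).braiding (u ⊗ₜ u') = ∑ g : G, Matrix.toLin' (actMat ξ μ j g 1) u' ⊗ₜ[k]
      Matrix.toLin' (coMat k μ j g) u := by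
  have h : (Y hξ μ j).coact u = ∑ g : G, et k g 1 ⊗ₜ[k] Matrix.toLin' (coMat k μ j g) u :=
    coactLin_apply μ j u
  simp only [YetterDrinfeldModule.braiding, LinearMap.comp_apply, LinearMap.rTensor_tmul, h,
    TensorProduct.sum_tmul, map_sum, LinearEquiv.coe_coe, TensorProduct.rightComm_tmul,
    TensorProduct.lift.tmul, AlgHom.toLinearMap_apply]
  exact Finset.sum_congr rfl fun g _ => by rw [← actHom_et (sq_of_primitive hξ)]; rfl

/-- These are the only coaction matrices that matter: t exchanges the two weight lines, so e_g t is
nonzero on v only for g = μy and on w only for g = μ. -/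
lemma M2.co_toG (b n : ℤ) (hb : b = 1 ∨ b = -1) (hn : n = 1 ∨ n = -1) (μ : Mu) :
    M2.co b n (μ.toG + (0, 1)) =
        (match μ with | .x => ((0, 1), (b, 0)) | .x3 => ((0, -b), (-1, 0))) ∧
      M2.co b n μ.toG =
        (match μ with | .x => ((0, n), (-(b * n), 0)) | .x3 => ((0, -(b * n)), (n, 0))) := by
  rcases hb with rfl | rfl <;> rcases hn with rfl | rfl <;> cases μ <;> decide +kernel

/-- With b, n, l standing for β, ν, λ, all sixteen modules are treated uniformly. Each value of c is
a single product of an entry of t and an entry of a coaction matrix. -/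
lemma exists_isRPM_braiding {ξ : k} (hξ : IsPrimitiveRoot ξ 4) (μ : Mu) (j : Fin 8) :
    ∃ r p : k, IsRPM (Y hξ μ j).braiding r p (-r) ∧ r ^ 2 = p ^ 2 ∧ p ≠ 0 := by
  obtain ⟨b, n, l, hb, hn, hX, hY, hT, hl⟩ := params ξ (sq_of_primitive hξ) μ j
  have hl0 : l ≠ 0 := by
    rintro rfl
    have hσ : sgm μ.toG 1 1 = 1 ∨ sgm μ.toG 1 1 = -1 := by cases μ <;> decide
    rcases hb with rfl | rfl <;> rcases hn with rfl | rfl <;> rcases hσ with h | h <;>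
      simp [h] at hl
  have hC : ∀ g, coMat k μ j g = (M2.co b n g).toMat := fun g => by
    simp [coMat, chiMat, hX, hY, M2.co, M2.chi, M2.toMat_smul, M2.toMat_mul, M2.toMat_pow,
      ← Int.cast_smul_eq_zsmul k]
  have hAv : ∀ g, Matrix.toLin' (actMat ξ μ j g 1) (Pi.single 0 1) =
      if g = μ.toG + (0, 1) then l • Pi.single 1 1 else 0 := fun g => by
    ext i; fin_cases i <;> simp [actMat, hT, eMat, M2.toMat, ZMod.val_one] <;> split_ifs <;> simp
  have hAw : ∀ g, Matrix.toLin' (actMat ξ μ j g 1) (Pi.single 1 1) =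
      if g = μ.toG then (-(b * n * l) : k) • Pi.single 0 1 else 0 := fun g => by
    ext i; fin_cases i <;> simp [actMat, hT, eMat, M2.toMat, ZMod.val_one] <;> split_ifs <;> simp
    ring
  have hv : ∀ u, (Y hξ μ j).braiding (u ⊗ₜ Pi.single 0 1) = (l • Pi.single 1 1) ⊗ₜ
      Matrix.toLin' (M2.co b n (μ.toG + (0, 1))).toMat u := fun u => by
    rw [braiding_tmul, Finset.sum_eq_single (μ.toG + (0, 1)) (fun g _ hg => by
      rw [hAv, if_neg hg, TensorProduct.zero_tmul]) (by simp), hAv, if_pos rfl, hC]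
  have hw : ∀ u, (Y hξ μ j).braiding (u ⊗ₜ Pi.single 1 1) = ((-(b * n * l) : k) • Pi.single 0 1) ⊗ₜ
      Matrix.toLin' (M2.co b n μ.toG).toMat u := fun u => by
    rw [braiding_tmul, Finset.sum_eq_single μ.toG (fun g _ hg => by
      rw [hAw, if_neg hg, TensorProduct.zero_tmul]) (by simp), hAw, if_pos rfl, hC]
  have toLin_v : ∀ a b c d : ℤ, Matrix.toLin' (M2.toMat (R := k) ((a, b), (c, d))) (Pi.single 0 1) =
      (a : k) • Pi.single 0 1 + (c : k) • Pi.single 1 1 := fun a b c d => by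
    ext i; fin_cases i <;> simp [M2.toMat]
  have toLin_w : ∀ a b c d : ℤ, Matrix.toLin' (M2.toMat (R := k) ((a, b), (c, d))) (Pi.single 1 1) =
      (b : k) • Pi.single 0 1 + (d : k) • Pi.single 1 1 := fun a b c d => by
    ext i; fin_cases i <;> simp [M2.toMat]
  have hco := M2.co_toG b n hb hn μ
  have hb2 : (b : k) ^ 2 = 1 := by rcases hb with rfl | rfl <;> simp
  have hn2 : (n : k) ^ 2 = 1 := by rcases hn with rfl | rfl <;> simp
  have hb0 : (b : k) ≠ 0 := by rintro h; simp [h] at hb2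
  generalize (Y hξ μ j).braiding = c at hv hw ⊢
  -- Read off from c(v ⊗ v) and c(w ⊗ v); then m = -r follows from b² = n² = 1.
  refine ⟨match μ with | .x => b * l | .x3 => -l, match μ with | .x => l | .x3 => -(b * l), ?_⟩
  cases μ <;> simp only at hco ⊢
  · refine ⟨⟨?_, ?_, ?_, ?_⟩, by linear_combination l ^ 2 * hb2, hl0⟩
    all_goals
      simp only [hv, hw, hco.1, hco.2, toLin_v, toLin_w,
        TensorProduct.tmul_smul, ← TensorProduct.smul_tmul', smul_smul, Int.cast_zero,
        zero_smul, zero_add, add_zero]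
    all_goals
      congr 1
      push_cast
      grobner
  · refine ⟨⟨?_, ?_, ?_, ?_⟩, by linear_combination -l ^ 2 * hb2, by simp [hb0, hl0]⟩
    all_goals
      simp only [hv, hw, hco.1, hco.2, toLin_v, toLin_w,
        TensorProduct.tmul_smul, ← TensorProduct.smul_tmul', smul_smul, Int.cast_zero,
        zero_smul, zero_add, add_zero]
    all_goals
      congr 1
      push_cast
      grobner

end Kashina
end

/-! ### The classification -/

theorem lemma5p4 {k : Type*} [Field k] [IsAlgClosed k] [CharZero k]
    {ξ : k} (hξ : IsPrimitiveRoot ξ 4) (μ : Kashina.Mu) (j : Fin 8) :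
    let c := (Kashina.Y hξ μ j).braiding
    let v : TensorAlgebra k (Fin 2 → k) := TensorAlgebra.ι k (Pi.single 0 1)
    let w : TensorAlgebra k (Fin 2 → k) := TensorAlgebra.ι k (Pi.single 1 1)
    (∃ r p m : k, BraidedSpace.IsRPM c r p m) ∧
    ¬ BraidedSpace.IsDiagonalType c ∧
    ∀ r p m : k, BraidedSpace.IsRPM c r p m →
      (p = -1 → r * m = -1 →
        BraidedSpace.IsPresentedBy c {v * w, w * v, v ^ 4 + w ^ 4} ∧
        Module.finrank k (BraidedSpace.NicholsAlgebra c) = 8) ∧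
      (p = 1 → ¬ Module.Finite k (BraidedSpace.NicholsAlgebra c)) ∧
      (r * m = 1 → (p = ξ ∨ p = -ξ) → r = -ξ →
        BraidedSpace.IsPresentedBy c {w ^ 2 - ξ • v ^ 2, v * w * v * w, w * v * w * v} ∧
        Nonempty (BraidedSpace.NicholsAlgebra c ≃ₐ[k] TensorAlgebra.QuotBy
          {w ^ 2 + ξ • v ^ 2, v * w * v * w, w * v * w * v}) ∧
        Module.finrank k (BraidedSpace.NicholsAlgebra c) = 16) ∧
      (r * m = 1 → (p = ξ ∨ p = -ξ) → r = ξ →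
        BraidedSpace.IsPresentedBy c {w ^ 2 + ξ • v ^ 2, v * w * v * w, w * v * w * v} ∧
        Nonempty (BraidedSpace.NicholsAlgebra c ≃ₐ[k] TensorAlgebra.QuotBy
          {w ^ 2 - ξ • v ^ 2, v * w * v * w, w * v * w * v}) ∧
        Module.finrank k (BraidedSpace.NicholsAlgebra c) = 16) := by
  intro c v w
  obtain ⟨r₀, p₀, hc₀, hrp, hp₀⟩ := Kashina.exists_isRPM_braiding hξ μ j
  have hr₀ : r₀ ≠ 0 := by rintro rfl; exact hp₀ (by simpa using hrp.symm)
  have hξ2 : ξ ^ 2 = -1 := Kashina.sq_of_primitive hξ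
  refine ⟨⟨r₀, p₀, -r₀, hc₀⟩, BraidedSpace.not_isDiagonalType hc₀ hr₀ (neg_ne_zero.mpr hr₀) ?_, ?_⟩
  -- Here rm = -r² = -p², so rm = p² would give 2p² = 0.
  · intro h
    have : (2 : k) * p₀ ^ 2 = 0 := by linear_combination -h - hrp
    exact hp₀ (by simpa using this)
  intro r p m hc
  obtain ⟨rfl, rfl, rfl⟩ := hc.unique hc₀
  -- Both sixteen-dimensional cases are instances of this, with s = -r = m: s = ξ when r = -ξ, and s
  -- = -ξ when r = ξ.
  have sixteen : ∀ s : k, s ^ 2 = -1 → (p = ξ ∨ p = -ξ) → r = -s →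
      BraidedSpace.IsPresentedBy c (BraidedSpace.rel16 s) ∧
      Nonempty (BraidedSpace.NicholsAlgebra c ≃ₐ[k]
        TensorAlgebra.QuotBy (BraidedSpace.rel16 (-s))) ∧
      Module.finrank k (BraidedSpace.NicholsAlgebra c) = 16 := by
    rintro s hs hp rfl
    have hp2 : p ^ 2 = -1 := by rcases hp with rfl | rfl <;> simp [hξ2]
    rw [neg_neg] at hc
    have h := BraidedSpace.presents_sixteen hs hp2 hc
    obtain ⟨e⟩ := BraidedSpace.nonempty_rel16_equiv_neg hs
    exact ⟨h.1, ⟨h.1.choose.trans e⟩, h.2⟩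
  refine ⟨?_, ?_, ?_, ?_⟩
  · rintro rfl -
    exact BraidedSpace.presents_eight (by simpa using hrp) hc
  · rintro rfl
    exact BraidedSpace.not_finite_nicholsAlgebra hc
  · intro _ hp hr
    rw [show w ^ 2 + ξ • v ^ 2 = w ^ 2 - (-ξ) • v ^ 2 by rw [neg_smul, sub_neg_eq_add]]
    exact sixteen ξ hξ2 hp hr
  · intro _ hp hr
    rw [show w ^ 2 + ξ • v ^ 2 = w ^ 2 - (-ξ) • v ^ 2 by rw [neg_smul, sub_neg_eq_add]]
    have h := sixteen (-ξ) (by rw [neg_sq, hξ2]) hp (by rw [neg_neg, hr])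
    rw [neg_neg] at h
    exact h
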